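/- Let $\Omega_{2D}\subset\mathbb{R}^2$ be a connected open set with Lipschitz boundary which, outside of a bounded region, coincides with a disjoint union of finitely many (at least one) semi-infinite strips, and assume that the Neumann Laplacian in $\Omega_{2D}$ has an eigenvalue $\lambda_\bullet>0$: there is a non-zero $\varphi\in H^1(\Omega_{2D})$ such that $\Delta\varphi+\lambda_\bullet\varphi=0$ in $\Omega_{2D}$ and $\partial_{\boldsymbol n}\varphi=0$ on $\partial\Omega_{2D}$, i.e. $\int_{\Omega_{2D}}\nabla\varphi\cdot\overline{\nabla\psi}=\lambda_\bullet\int_{\Omega_{2D}}\varphi\,\overline{\psi}$ for all $\psi\in H^1(\Omega_{2D})$. For $a>0$ let $\Omega=(0,a)\times\Omega_{2D}$, with coordinates $x\in(0,a)$, $(y,z)\in\Omega_{2D}$. Let $A$ be the electric Maxwell operator in $\Omega$ with perfect conductor boundary conditions, that is, the unbounded operator in the Hilbert space $\{\boldsymbol E\in L^2(\Omega)^3 : \operatorname{div}\boldsymbol E=0 \text{ in } \Omega\}$ given by $A\boldsymbol E=\operatorname{curl}\operatorname{curl}\boldsymbol E$ on the domain $$D(A)=\{\boldsymbol E\in L^2(\Omega)^3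 : \operatorname{div}\boldsymbol E=0,\ \operatorname{curl}\boldsymbol E\in L^2(\Omega)^3,\ \boldsymbol E\times\boldsymbol\nu=0\text{ on }\partial\Omega,\ \operatorname{curl}\operatorname{curl}\boldsymbol E\in L^2(\Omega)^3\},$$ where $\boldsymbol\nu$ is the unit outward normal to $\partial\Omega$. Then for every integer $m\ge1$ the number $\lambda_\bullet+m^2\pi^2/a^2$ is an eigenvalue of $A$ and belongs to the essential spectrum of $A$, i.e. it is an embedded eigenvalue. Moreover, for every eigenfunction $\varphi$ of the Neumann Laplacian in $\Omega_{2D}$ associated with $\lambda_\bullet$, the field $$\boldsymbol E(x,y,z)=\begin{pmatrix}0\\ \sin(m\pi x/a)\,\partial_z\varphi(y,z)\\ -\sin(m\pi x/a)\,\partial_y\varphi(y,z)\end{pmatrix}$$ is an eigenfunction of $A$ for the eigenvalue $\lambda_\bullet+m^2\pi^2/a^2$ (it is non-zero, lies in $D(A)$ and satisfies $A\boldsymbol E=(\lambda_\bullet+m^2\pi^2/a^2)\boldsymbol E$). -/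

import Mathlib

open MeasureTheory Filter Topology
open scoped ContDiff

namespace MaxwellGuide

noncomputable section

/-! ### Spectral notions for an unbounded operator on a complex inner product space -/

section Spectral

variable {H : Type*} [NormedAddCommGroup H] [InnerProductSpace ℂ H]

/-- `u` is an eigenvector of the unbounded operator `A` for the value `lam`. -/
def IsEigenvector (A : H →ₗ.[ℂ] H) (lam : ℂ) (u : A.domain) : Prop :=
  u ≠ 0 ∧ A u = lam • (u : H)

/-- The point spectrum: the set of eigenvalues. -/
def pointSpectrum (A : H →ₗ.[ℂ] H) : Set ℂ :=
  {lam | ∃ u : A.domain, IsEigenvector A lam u}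

/-- The essential spectrum (of a self-adjoint operator), through singular Weyl sequences:
normalized sequences `u n` of the domain that tend weakly to zero and for which
`(A - lam) (u n)` tends to zero in norm. -/
def essentialSpectrum (A : H →ₗ.[ℂ] H) : Set ℂ :=
  {lam | ∃ u : ℕ → A.domain,
    (∀ n, ‖(u n : H)‖ = 1) ∧
    (∀ v : H, Tendsto (fun n => inner ℂ v (u n : H)) atTop (𝓝 0)) ∧
    Tendsto (fun n => A (u n) - lam • (u n : H)) atTop (𝓝 0)}

/-- Embedded eigenvalues: eigenvalues that lie in the essential spectrum. -/
def embeddedEigenvalues (A : H →ₗ.[ℂ] H) : Set ℂ :=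
  pointSpectrum A ∩ essentialSpectrum A

end Spectral

/-! ### Differential operators on smooth functions -/

/-- The plane, with coordinates `(y, z)`. -/
abbrev Plane := EuclideanSpace ℝ (Fin 2)

/-- The space, with coordinates `(x, y, z)`. -/
abbrev Space := EuclideanSpace ℝ (Fin 3)

/-- The partial derivative of `f` with respect to the `i`-th coordinate. -/
def partialDeriv {n : ℕ} (i : Fin n) (f : EuclideanSpace ℝ (Fin n) → ℝ)
    (p : EuclideanSpace ℝ (Fin n)) : ℝ :=
  fderiv ℝ f p (EuclideanSpace.single i 1)

/-- The gradient of a smooth function of three variables. -/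
def grad (f : Space → ℝ) (p : Space) : Space :=
  !₂[partialDeriv 0 f p, partialDeriv 1 f p, partialDeriv 2 f p]

/-- The curl of a smooth field of three variables. -/
def curl (V : Space → Space) (p : Space) : Space :=
  !₂[partialDeriv 1 (fun q => V q 2) p - partialDeriv 2 (fun q => V q 1) p,
     partialDeriv 2 (fun q => V q 0) p - partialDeriv 0 (fun q => V q 2) p,
     partialDeriv 0 (fun q => V q 1) p - partialDeriv 1 (fun q => V q 0) p]

/-! ### The Maxwell operator -/

/-- Square integrable complex vector fields on `Ω`. -/
abbrev VecL2 (Ω : TopologicalSpace.Opens Space) :=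
  Lp (EuclideanSpace ℂ (Fin 3)) 2 (volume.restrict (Ω : Set Space))

/-- The bilinear pairing `∫_Ω E · Φ` of an `L²` field with a real test field. -/
def pairing (Ω : TopologicalSpace.Opens Space) (E : VecL2 Ω) (Φ : Space → Space) : ℂ :=
  ∫ p in (Ω : Set Space), ∑ i, E p i * (Φ p i : ℂ)

/-- `F` is the curl of `E` in `Ω` in the sense of distributions. -/
def IsWeakCurl {Ω : TopologicalSpace.Opens Space} (E F : VecL2 Ω) : Prop :=
  ∀ Φ : Space → Space, ContDiff ℝ ∞ Φ → HasCompactSupport Φ → tsupport Φ ⊆ (Ω : Set Space) →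
    pairing Ω E (curl Φ) = pairing Ω F Φ

/-- The field `E`, whose curl in `Ω` is `F`, has zero tangential trace `E × ν = 0` on `∂Ω`, in
the sense of Green's formula `∫_Ω (E · curl Φ - curl E · Φ) = ⟨E × ν, Φ⟩_{∂Ω}`, in which `Φ` runs
over the restrictions to `Ω` of smooth compactly supported fields of the whole space. -/
def HasZeroTangentialTrace {Ω : TopologicalSpace.Opens Space} (E F : VecL2 Ω) : Prop :=
  ∀ Φ : Space → Space, ContDiff ℝ ∞ Φ → HasCompactSupport Φ →
    pairing Ω E (curl Φ) - pairing Ω F Φ = 0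

/-- `div E = 0` in `Ω` in the sense of distributions. -/
def IsDivFree {Ω : TopologicalSpace.Opens Space} (E : VecL2 Ω) : Prop :=
  ∀ ψ : Space → ℝ, ContDiff ℝ ∞ ψ → HasCompactSupport ψ → tsupport ψ ⊆ (Ω : Set Space) →
    pairing Ω E (grad ψ) = 0

lemma continuous_partialDeriv {n : ℕ} {f : EuclideanSpace ℝ (Fin n) → ℝ} (hf : ContDiff ℝ ∞ f)
    (i : Fin n) : Continuous (partialDeriv i f) :=
  (hf.continuous_fderiv (by simp)).clm_apply continuous_const

lemma hasCompactSupport_partialDeriv {n : ℕ} {f : EuclideanSpace ℝ (Fin n) → ℝ}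
    (hf : HasCompactSupport f) (i : Fin n) : HasCompactSupport (partialDeriv i f) :=
  (hf.fderiv ℝ).comp_left
    (g := fun L : EuclideanSpace ℝ (Fin n) →L[ℝ] ℝ => L (EuclideanSpace.single i 1)) (by simp)

lemma contDiff_coord {V : Space → Space} (hV : ContDiff ℝ ∞ V) (i : Fin 3) :
    ContDiff ℝ ∞ (fun p => V p i) :=
  contDiff_euclidean.1 hV i

lemma hasCompactSupport_coord {V : Space → Space} (hV : HasCompactSupport V) (i : Fin 3) :
    HasCompactSupport (fun p => V p i) :=
  hV.comp_left (g := fun v : Space => v i) (by simp)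

/-- Coordinates are continuous and compactly supported: the fields that may be paired. -/
def IsTestField (Φ : Space → Space) : Prop :=
  ∀ i, Continuous (fun p => Φ p i) ∧ HasCompactSupport (fun p => Φ p i)

lemma isTestField_of_smooth {V : Space → Space} (hV : ContDiff ℝ ∞ V) (hc : HasCompactSupport V) :
    IsTestField V :=
  fun i => ⟨(contDiff_coord hV i).continuous, hasCompactSupport_coord hc i⟩

lemma isTestField_curl {V : Space → Space} (hV : ContDiff ℝ ∞ V) (hc : HasCompactSupport V) :
    IsTestField (curl V) := by
  have h1 := fun i j => continuous_partialDeriv (contDiff_coord hV i) j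
  have h2 := fun i j => hasCompactSupport_partialDeriv (hasCompactSupport_coord hc i) j
  intro i
  fin_cases i
  · exact ⟨(h1 2 1).sub (h1 1 2), (h2 2 1).sub (h2 1 2)⟩
  · exact ⟨(h1 0 2).sub (h1 2 0), (h2 0 2).sub (h2 2 0)⟩
  · exact ⟨(h1 1 0).sub (h1 0 1), (h2 1 0).sub (h2 0 1)⟩

lemma contDiff_grad {f : Space → ℝ} (hf : ContDiff ℝ ∞ f) : ContDiff ℝ ∞ (grad f) := by
  have h : ∀ i, ContDiff ℝ ∞ (partialDeriv i f) := fun i =>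
    (hf.fderiv_right (m := ∞) (by simp)).clm_apply contDiff_const
  refine contDiff_euclidean.2 fun i => ?_
  fin_cases i
  · exact h 0
  · exact h 1
  · exact h 2

lemma grad_eq_zero {f : Space → ℝ} {p : Space} (hp : p ∉ tsupport f) : grad f p = 0 := by
  have h : fderiv ℝ f p = 0 := by
    by_contra h
    exact hp (support_fderiv_subset ℝ h)
  ext i
  fin_cases i <;> simp [grad, partialDeriv, h]

lemma tsupport_grad_subset (f : Space → ℝ) : tsupport (grad f) ⊆ tsupport f := by
  refine closure_minimal (fun p hp => ?_) (isClosed_tsupport f)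
  by_contra h
  exact hp (grad_eq_zero h)

lemma hasCompactSupport_grad {f : Space → ℝ} (hf : HasCompactSupport f) :
    HasCompactSupport (grad f) :=
  hf.of_isClosed_subset (isClosed_tsupport _) (tsupport_grad_subset f)

lemma partialDeriv_comm {f : Space → ℝ} (hf : ContDiff ℝ ∞ f) (i j : Fin 3) (p : Space) :
    partialDeriv i (partialDeriv j f) p = partialDeriv j (partialDeriv i f) p := by
  have hd : DifferentiableAt ℝ (fderiv ℝ f) p :=
    ((hf.fderiv_right (m := ∞) (by simp)).differentiable (by simp)) p
  have key : ∀ k l : Fin 3, partialDeriv k (partialDeriv l f) p =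
      fderiv ℝ (fderiv ℝ f) p (EuclideanSpace.single k 1) (EuclideanSpace.single l 1) := by
    intro k l
    unfold partialDeriv
    rw [fderiv_clm_apply hd (by fun_prop)]
    simp
  have hs : IsSymmSndFDerivAt ℝ f p := by
    refine hf.contDiffAt.isSymmSndFDerivAt ?_
    simp only [minSmoothness_of_isRCLikeNormedField]
    exact WithTop.coe_le_coe.2 le_top
  rw [key, key]
  exact hs _ _

lemma curl_grad {f : Space → ℝ} (hf : ContDiff ℝ ∞ f) : curl (grad f) = 0 := by
  funext p
  ext i
  have h := fun i j => sub_eq_zero.2 (partialDeriv_comm hf i j p)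
  fin_cases i
  · exact h 1 2
  · exact h 2 0
  · exact h 0 1

section Pairing

variable {Ω : TopologicalSpace.Opens Space}

lemma memLp_coord (E : VecL2 Ω) (i : Fin 3) :
    MemLp (fun p => E p i) 2 (volume.restrict (Ω : Set Space)) :=
  (Lp.memLp E).continuousLinearMap_comp (EuclideanSpace.proj (𝕜 := ℂ) i)

lemma integrable_pairing (E : VecL2 Ω) {Φ : Space → Space} (hΦ : IsTestField Φ) :
    Integrable (fun p => ∑ i, E p i * (Φ p i : ℂ)) (volume.restrict (Ω : Set Space)) := by
  refine integrable_finsetSum _ fun i _ => ?_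
  have hc : HasCompactSupport (fun p => (Φ p i : ℂ)) :=
    (hΦ i).2.comp_left (g := fun r : ℝ => (r : ℂ)) (by simp)
  have hm : MemLp (fun p => (Φ p i : ℂ)) 2 (volume.restrict (Ω : Set Space)) :=
    (Complex.continuous_ofReal.comp (hΦ i).1).memLp_of_hasCompactSupport hc
  exact (memLp_coord E i).integrable_mul hm

lemma pairing_add (E F : VecL2 Ω) {Φ : Space → Space} (hΦ : IsTestField Φ) :
    pairing Ω (E + F) Φ = pairing Ω E Φ + pairing Ω F Φ := by
  unfold pairing
  rw [← integral_add (integrable_pairing E hΦ) (integrable_pairing F hΦ)]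
  refine integral_congr_ae ?_
  filter_upwards [Lp.coeFn_add E F] with p hp
  simp only [hp, Pi.add_apply, PiLp.add_apply, add_mul, Finset.sum_add_distrib]

lemma pairing_smul (c : ℂ) (E : VecL2 Ω) (Φ : Space → Space) :
    pairing Ω (c • E) Φ = c * pairing Ω E Φ := by
  unfold pairing
  rw [← integral_const_mul]
  refine integral_congr_ae ?_
  filter_upwards [Lp.coeFn_smul c E] with p hp
  simp [hp, Finset.mul_sum, mul_assoc]

lemma pairing_zero (Φ : Space → Space) : pairing Ω (0 : VecL2 Ω) Φ = 0 := by
  have h := pairing_smul (0 : ℂ) (0 : VecL2 Ω) Φ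
  simpa using h

/-- A field that pairs to zero with all test fields supported in `Ω` vanishes. -/
lemma eq_zero_of_pairing {E : VecL2 Ω}
    (h : ∀ Φ : Space → Space, ContDiff ℝ ∞ Φ → HasCompactSupport Φ →
      tsupport Φ ⊆ (Ω : Set Space) → pairing Ω E Φ = 0) : E = 0 := by
  have hi : ∀ i : Fin 3, ∀ᵐ p ∂(volume : Measure Space), p ∈ (Ω : Set Space) → E p i = 0 := by
    intro i
    refine Ω.isOpen.ae_eq_zero_of_integral_contDiff_smul_eq_zero
      (locallyIntegrableOn_of_locallyIntegrable_restrict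
        ((memLp_coord E i).locallyIntegrable (by norm_num))) ?_
    intro g hg hgc hgs
    have hsub : tsupport (fun p => EuclideanSpace.single i (g p)) ⊆ tsupport g := by
      refine closure_mono fun p hp => ?_
      intro h0
      exact hp (by simp [h0])
    have h1 := h (fun p => EuclideanSpace.single i (g p))
      (contDiff_euclidean.2 fun j => by
        by_cases hj : j = i
        · subst hj; simpa using hg
        · simpa [hj] using contDiff_const)
      (hgc.of_isClosed_subset (isClosed_tsupport _) hsub) (hsub.trans hgs)
    have h2 : ∫ p in (Ω : Set Space), g p • E p i = 0 := by
      rw [← h1]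
      unfold pairing
      refine integral_congr_ae (Eventually.of_forall fun p => ?_)
      have : ∀ j, E p j * ((EuclideanSpace.single i (g p) : Space) j : ℂ) =
          if j = i then g p • E p i else 0 := by
        intro j
        by_cases hj : j = i
        · subst hj; simp [mul_comm]
        · simp [hj]
      simp only [this]
      simp
    rw [← h2, setIntegral_eq_integral_of_forall_compl_eq_zero]
    intro p hp
    have : g p = 0 := by
      by_contra h0
      exact hp (hgs (subset_tsupport _ h0))
    simp [this]
  refine Lp.ext ?_
  have hall := ae_all_iff.2 hi
  filter_upwards [(ae_restrict_iff' Ω.isOpen.measurableSet).2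
    (hall.mono fun p hp hpm i => hp i hpm), Lp.coeFn_zero (EuclideanSpace ℂ (Fin 3)) 2
      (volume.restrict (Ω : Set Space))] with p hp h0
  rw [h0]
  ext i
  simpa using hp i

lemma IsWeakCurl.add {E F E' F' : VecL2 Ω} (h : IsWeakCurl E F) (h' : IsWeakCurl E' F') :
    IsWeakCurl (E + E') (F + F') := by
  intro Φ h1 h2 h3
  rw [pairing_add _ _ (isTestField_curl h1 h2), pairing_add _ _ (isTestField_of_smooth h1 h2),
    h Φ h1 h2 h3, h' Φ h1 h2 h3]

lemma IsWeakCurl.smul {E F : VecL2 Ω} (c : ℂ) (h : IsWeakCurl E F) :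
    IsWeakCurl (c • E) (c • F) := by
  intro Φ h1 h2 h3
  rw [pairing_smul, pairing_smul, h Φ h1 h2 h3]

lemma HasZeroTangentialTrace.add {E F E' F' : VecL2 Ω} (h : HasZeroTangentialTrace E F)
    (h' : HasZeroTangentialTrace E' F') : HasZeroTangentialTrace (E + E') (F + F') := by
  intro Φ h1 h2
  rw [pairing_add _ _ (isTestField_curl h1 h2), pairing_add _ _ (isTestField_of_smooth h1 h2)]
  linear_combination h Φ h1 h2 + h' Φ h1 h2

lemma HasZeroTangentialTrace.smul {E F : VecL2 Ω} (c : ℂ) (h : HasZeroTangentialTrace E F) :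
    HasZeroTangentialTrace (c • E) (c • F) := by
  intro Φ h1 h2
  rw [pairing_smul, pairing_smul]
  linear_combination c * h Φ h1 h2

/-- The weak curl is unique. -/
lemma IsWeakCurl.unique {E F F' : VecL2 Ω} (h : IsWeakCurl E F) (h' : IsWeakCurl E F') :
    F = F' := by
  have key : F + (-1 : ℂ) • F' = 0 := by
    refine eq_zero_of_pairing fun Φ h1 h2 h3 => ?_
    rw [pairing_add _ _ (isTestField_of_smooth h1 h2), pairing_smul, ← h Φ h1 h2 h3,
      ← h' Φ h1 h2 h3]
    ring
  rw [neg_one_smul] at key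
  exact add_neg_eq_zero.1 key

/-- A curl is divergence free. -/
lemma IsWeakCurl.isDivFree {E F : VecL2 Ω} (h : IsWeakCurl E F) : IsDivFree F := by
  intro ψ h1 h2 h3
  rw [← h (grad ψ) (contDiff_grad h1) (hasCompactSupport_grad h2)
    ((tsupport_grad_subset ψ).trans h3), curl_grad h1]
  simp [pairing]

end Pairing

/-- The space `H(div; 0)` of divergence free `L²` fields on `Ω`. -/
def HDiv0 (Ω : TopologicalSpace.Opens Space) : Submodule ℂ (VecL2 Ω) where
  carrier := {E | IsDivFree E}
  zero_mem' := fun _ _ _ _ => pairing_zero _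
  add_mem' := by
    intro E F hE hF ψ h1 h2 h3
    rw [pairing_add _ _ (isTestField_of_smooth (contDiff_grad h1) (hasCompactSupport_grad h2)),
      hE ψ h1 h2 h3, hF ψ h1 h2 h3, add_zero]
  smul_mem' := by
    intro c E hE ψ h1 h2 h3
    rw [pairing_smul, hE ψ h1 h2 h3, mul_zero]

/-- `E ∈ H_N(curl)` (i.e. `curl E ∈ L²` and `E × ν = 0` on `∂Ω`) and `curl curl E = G ∈ L²`. -/
def IsCurlCurl {Ω : TopologicalSpace.Opens Space} (E G : VecL2 Ω) : Prop :=
  ∃ F : VecL2 Ω, IsWeakCurl E F ∧ HasZeroTangentialTrace E F ∧ IsWeakCurl F G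

section CurlCurl

variable {Ω : TopologicalSpace.Opens Space}

lemma IsCurlCurl.add {E G E' G' : VecL2 Ω} (h : IsCurlCurl E G) (h' : IsCurlCurl E' G') :
    IsCurlCurl (E + E') (G + G') := by
  obtain ⟨F, h1, h2, h3⟩ := h
  obtain ⟨F', h1', h2', h3'⟩ := h'
  exact ⟨F + F', h1.add h1', h2.add h2', h3.add h3'⟩

lemma IsCurlCurl.smul {E G : VecL2 Ω} (c : ℂ) (h : IsCurlCurl E G) :
    IsCurlCurl (c • E) (c • G) := by
  obtain ⟨F, h1, h2, h3⟩ := h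
  exact ⟨c • F, h1.smul c, h2.smul c, h3.smul c⟩

lemma IsCurlCurl.zero : IsCurlCurl (0 : VecL2 Ω) 0 :=
  ⟨0, fun _ _ _ _ => by rw [pairing_zero, pairing_zero],
    fun _ _ _ => by rw [pairing_zero, pairing_zero, sub_zero],
    fun _ _ _ _ => by rw [pairing_zero, pairing_zero]⟩

lemma IsCurlCurl.unique {E G G' : VecL2 Ω} (h : IsCurlCurl E G) (h' : IsCurlCurl E G') :
    G = G' := by
  obtain ⟨F, h1, -, h3⟩ := h
  obtain ⟨F', h1', -, h3'⟩ := h'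
  obtain rfl := h1.unique h1'
  exact h3.unique h3'

lemma IsCurlCurl.isDivFree {E G : VecL2 Ω} (h : IsCurlCurl E G) : IsDivFree G := by
  obtain ⟨F, -, -, h3⟩ := h
  exact h3.isDivFree

end CurlCurl

/-- The electric Maxwell operator `A = curl curl` in the Hilbert space `H(div; 0)`, with domain
the `E` such that `curl E ∈ L²`, `E × ν = 0` on `∂Ω`, `div E = 0` and `curl curl E ∈ L²`. -/
def maxwellOperator (Ω : TopologicalSpace.Opens Space) : HDiv0 Ω →ₗ.[ℂ] HDiv0 Ω where
  domain :=
    { carrier := {E | ∃ G : VecL2 Ω, IsCurlCurl (E : VecL2 Ω) G}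
      zero_mem' := ⟨0, IsCurlCurl.zero⟩
      add_mem' := by
        rintro E E' ⟨G, h⟩ ⟨G', h'⟩
        exact ⟨G + G', h.add h'⟩
      smul_mem' := by
        rintro c E ⟨G, h⟩
        exact ⟨c • G, h.smul c⟩ }
  toFun :=
    { toFun := fun E => ⟨E.2.choose, E.2.choose_spec.isDivFree⟩
      map_add' := by
        intro E E'
        exact Subtype.ext ((E + E').2.choose_spec.unique
          (E.2.choose_spec.add E'.2.choose_spec))
      map_smul' := by
        intro c E
        exact Subtype.ext ((c • E).2.choose_spec.unique (E.2.choose_spec.smul c)) }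

/-- The value of the operator is characterized by `curl curl E = G`. -/
lemma maxwellOperator_apply_eq_iff {Ω : TopologicalSpace.Opens Space}
    (E : (maxwellOperator Ω).domain) (G : HDiv0 Ω) :
    maxwellOperator Ω E = G ↔ IsCurlCurl ((E : HDiv0 Ω) : VecL2 Ω) (G : VecL2 Ω) := by
  have hs : IsCurlCurl ((E : HDiv0 Ω) : VecL2 Ω) (maxwellOperator Ω E : VecL2 Ω) :=
    E.2.choose_spec
  constructor
  · rintro rfl
    exact hs
  · intro h
    exact Subtype.ext (hs.unique h)

/-! ### The Neumann Laplacian in a plane domain -/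

/-- `g` is the gradient of `φ` in `U` in the sense of distributions; thus `φ ∈ H¹(U)`. -/
def IsWeakGradient {U : TopologicalSpace.Opens Plane}
    (φ : Lp ℂ 2 (volume.restrict (U : Set Plane)))
    (g : Lp (EuclideanSpace ℂ (Fin 2)) 2 (volume.restrict (U : Set Plane))) : Prop :=
  ∀ ψ : Plane → ℝ, ContDiff ℝ ∞ ψ → HasCompactSupport ψ → tsupport ψ ⊆ (U : Set Plane) →
    ∀ i : Fin 2, ∫ p in (U : Set Plane), φ p * (partialDeriv i ψ p : ℂ) =
      -∫ p in (U : Set Plane), g p i * (ψ p : ℂ)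

/-- `φ` is an eigenfunction, with gradient `g`, of the Neumann Laplacian in `U` for the value
`lam`: `φ ∈ H¹(U)`, `φ ≠ 0`, `-Δφ = lam φ` in `U` and `∂ₙφ = 0` on `∂U`, in the usual variational
form `∫_U ∇φ · ∇ψ = lam ∫_U φ ψ` for all `ψ ∈ H¹(U)` (with complex conjugation on `ψ`). -/
def IsNeumannEigenfunction {U : TopologicalSpace.Opens Plane} (lam : ℝ)
    (φ : Lp ℂ 2 (volume.restrict (U : Set Plane)))
    (g : Lp (EuclideanSpace ℂ (Fin 2)) 2 (volume.restrict (U : Set Plane))) : Prop :=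
  φ ≠ 0 ∧ IsWeakGradient φ g ∧
    ∀ (ψ : Lp ℂ 2 (volume.restrict (U : Set Plane)))
      (h : Lp (EuclideanSpace ℂ (Fin 2)) 2 (volume.restrict (U : Set Plane))),
      IsWeakGradient ψ h → inner ℂ h g = (lam : ℂ) * inner ℂ ψ φ

/-- `lam` is an eigenvalue of the Neumann Laplacian in `U`. -/
def IsNeumannEigenvalue (U : TopologicalSpace.Opens Plane) (lam : ℝ) : Prop :=
  ∃ φ g, IsNeumannEigenfunction (U := U) lam φ g

/-! ### Geometry -/

/-- `U` has a Lipschitz boundary: near each boundary point and in suitable Cartesian coordinates,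
`U` is the set of points above the graph of a Lipschitz function. -/
def HasLipschitzBoundary (U : Set Plane) : Prop :=
  ∀ p ∈ frontier U, ∃ (e : Plane ≃ᵃⁱ[ℝ] Plane) (r : ℝ) (K : NNReal) (γ : ℝ → ℝ),
    0 < r ∧ LipschitzWith K γ ∧ ∀ q ∈ Metric.ball p r, (q ∈ U ↔ γ (e q 0) < e q 1)

/-- The semi-infinite strip of height `h` in the direction of the unit vector `d`, one corner of
which is the point `c`. -/
def semiStrip (c d : Plane) (h : ℝ) : Set Plane :=
  {q | ∃ t s : ℝ, 0 < t ∧ 0 < s ∧ s < h ∧ q = c + t • d + s • !₂[-d 1, d 0]}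

/-- Outside a bounded region, `U` is the disjoint union of finitely many (and at least one)
semi-infinite strips. -/
def HasStripOutlets (U : Set Plane) : Prop :=
  ∃ (M : ℕ) (c d : Fin M → Plane) (h : Fin M → ℝ) (R : ℝ),
    0 < M ∧ (∀ i, ‖d i‖ = 1) ∧ (∀ i, 0 < h i) ∧
    (U \ Metric.ball 0 R = (⋃ i, semiStrip (c i) (d i) (h i)) \ Metric.ball 0 R) ∧
    ∀ i j, i ≠ j → Disjoint (semiStrip (c i) (d i) (h i) \ Metric.ball 0 R)
      (semiStrip (c j) (d j) (h j) \ Metric.ball 0 R)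

/-- The product domain `(0, a) × U`. -/
def productGuide (a : ℝ) (U : TopologicalSpace.Opens Plane) : TopologicalSpace.Opens Space where
  carrier := {p | p 0 ∈ Set.Ioo 0 a ∧ !₂[p 1, p 2] ∈ (U : Set Plane)}
  is_open' := by
    refine IsOpen.inter (isOpen_Ioo.preimage (by fun_prop)) (U.isOpen.preimage ?_)
    refine (PiLp.continuous_toLp 2 _).comp (continuous_pi fun i => ?_)
    fin_cases i
    · exact (EuclideanSpace.proj (𝕜 := ℝ) (1 : Fin 3)).continuous
    · exact (EuclideanSpace.proj (𝕜 := ℝ) (2 : Fin 3)).continuous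

/-- The field `(0, sin (m π x / a) ∂_z φ (y, z), - sin (m π x / a) ∂_y φ (y, z))`, where
`g = (∂_y φ, ∂_z φ)`. -/
def trappedField (a : ℝ) (m : ℕ) (g : Plane → EuclideanSpace ℂ (Fin 2)) (p : Space) :
    EuclideanSpace ℂ (Fin 3) :=
  !₂[0, (Real.sin (m * Real.pi * p 0 / a) : ℂ) * g !₂[p 1, p 2] 1,
    -((Real.sin (m * Real.pi * p 0 / a) : ℂ) * g !₂[p 1, p 2] 0)]

end

end MaxwellGuide

namespace MaxwellGuide

noncomputable section

/-! ### The product structure of the space -/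

/-! Put `k = mπ/a` and lift a plane field `g` to `sin(kx) (0, g₁, -g₀)`. If `g` is curl free, `-div
g = w` and `g · n = 0` on `∂U`, then the lift is divergence free and its curl is `(sin(kx) w, k
cos(kx) g₀, k cos(kx) g₁)`. Its tangential trace vanishes, on the end faces because the sine does
and on the lateral boundary because `g` has no normal flux. Its double curl is the lift of `∇w + k²
g` (`isCurlCurl_trappedLp`). On such lifts the Maxwell operator is therefore `-∇ div + k²`, and both
halves of the theorem amount to a choice of `g`.

For the eigenvalue, `g = ∇φ` and `w = λφ`, so `∇w + k² g = (λ + k²) g`. The lift is non-zero because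
a vanishing gradient would force `λ‖φ‖² = 0` and because the sine mode is not zero for `m ≥ 1`
(`IsNeumannEigenfunction.exists_isEigenvector`).

For the essential spectrum only one strip is needed. In coordinates `(t, s)` along and across an
outlet, `g = ρ(t) d` is curl free and tangent to the walls, and `-∇ div g = -ρ'' d`. With `ρ(t) =
exp(iζt) χ(εt)`, `ζ² = λ`, the residual `-ρ'' - λρ` is `O(ε)` relative to `ρ`. Taking `ε = 2⁻ⁿ`
makes the supports disjoint, so the normalized lifts are orthonormal, hence weakly null, and form a
Weyl sequence for `λ + k²` (`mem_essentialSpectrum_of_orthogonal`,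
`IsOutlet.mem_essentialSpectrum`). This works for every `λ > 0`: these numbers all belong to the
continuum above the threshold `k²`. -/

/-- The point of the space with coordinates `(x, q)`. -/
def joinPoint (x : ℝ) (q : Plane) : Space := !₂[x, q 0, q 1]

/-- The transverse coordinates of a point of the space. -/
def planePart (p : Space) : Plane := !₂[p 1, p 2]

@[simp] lemma joinPoint_zero (x : ℝ) (q : Plane) : joinPoint x q 0 = x := rfl

@[simp] lemma planePart_joinPoint (x : ℝ) (q : Plane) : planePart (joinPoint x q) = q := by
  ext i
  fin_cases i <;> rfl

lemma joinPoint_planePart (p : Space) : joinPoint (p 0) (planePart p) = p := by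
  ext i
  fin_cases i <;> rfl

/-- The identification of the space with the product of a line and a plane. -/
def spaceEquiv : Space ≃ᵐ ℝ × Plane :=
  (MeasurableEquiv.toLp 2 (Fin 3 → ℝ)).symm.trans
    ((MeasurableEquiv.piFinSuccAbove (fun _ : Fin 3 => ℝ) 0).trans
      ((MeasurableEquiv.refl ℝ).prodCongr (MeasurableEquiv.toLp 2 (Fin 2 → ℝ))))

lemma spaceEquiv_apply (p : Space) : spaceEquiv p = (p 0, planePart p) := by
  refine Prod.ext rfl ?_
  ext i
  fin_cases i <;> rfl

lemma measurePreserving_spaceEquiv : MeasurePreserving spaceEquiv := by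
  refine (EuclideanSpace.volume_preserving_symm_measurableEquiv_toLp (Fin 3)).trans ?_
  refine (volume_preserving_piFinSuccAbove (fun _ : Fin 3 => ℝ) 0).trans ?_
  exact (MeasurePreserving.id _).prod (PiLp.volume_preserving_toLp (Fin 2))

lemma contDiff_joinPoint_right (x : ℝ) : ContDiff ℝ ∞ (joinPoint x) := by
  refine contDiff_euclidean.2 fun i => ?_
  fin_cases i
  · exact contDiff_const
  · exact contDiff_euclidean.1 contDiff_id 0
  · exact contDiff_euclidean.1 contDiff_id 1

lemma hasDerivAt_joinPoint_left (x : ℝ) (q : Plane) :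
    HasDerivAt (fun t => joinPoint t q) (EuclideanSpace.single 0 1) x := by
  have h : (fun t => joinPoint t q) =
      fun t : ℝ => joinPoint 0 q + t • EuclideanSpace.single 0 (1 : ℝ) := by
    funext t
    ext i
    fin_cases i <;> simp [joinPoint]
  rw [h]
  simpa using ((hasDerivAt_id x).smul_const
    (EuclideanSpace.single (0 : Fin 3) (1 : ℝ))).const_add (joinPoint 0 q)

lemma continuous_planePart : Continuous planePart := by
  refine (PiLp.continuous_toLp 2 _).comp (continuous_pi fun i => ?_)
  fin_cases i
  · exact (EuclideanSpace.proj (𝕜 := ℝ) (1 : Fin 3)).continuous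
  · exact (EuclideanSpace.proj (𝕜 := ℝ) (2 : Fin 3)).continuous

/-! ### Restriction of test functions to transverse planes -/

section Slices

variable {ψ : Space → ℝ}

/-- The restriction of a function to the plane of abscissa `x`. -/
def planeSlice (ψ : Space → ℝ) (x : ℝ) (q : Plane) : ℝ := ψ (joinPoint x q)

lemma contDiff_planeSlice (hψ : ContDiff ℝ ∞ ψ) (x : ℝ) : ContDiff ℝ ∞ (planeSlice ψ x) :=
  hψ.comp (contDiff_joinPoint_right x)

/-- The right-hand side is the projection of a compact set, hence already closed, so no closure has
to be taken after projecting. Keeping the points of `tsupport ψ` explicit lets support conditions in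
the guide pass to the cross-section. -/
lemma tsupport_planeSlice_subset (hc : HasCompactSupport ψ) (x : ℝ) :
    tsupport (planeSlice ψ x) ⊆ planePart '' {p ∈ tsupport ψ | p 0 = x} := by
  have hcl : IsClosed (planePart '' {p ∈ tsupport ψ | p 0 = x}) := by
    refine IsCompact.isClosed (IsCompact.image ?_ continuous_planePart)
    exact hc.isCompact.inter_right
      (isClosed_eq (EuclideanSpace.proj (𝕜 := ℝ) (0 : Fin 3)).continuous continuous_const)
  refine closure_minimal (fun q hq => ?_) hcl
  exact ⟨joinPoint x q, ⟨subset_tsupport _ hq, rfl⟩, planePart_joinPoint x q⟩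

lemma hasCompactSupport_planeSlice (hc : HasCompactSupport ψ) (x : ℝ) :
    HasCompactSupport (planeSlice ψ x) := by
  refine IsCompact.of_isClosed_subset ?_ (isClosed_tsupport _) (tsupport_planeSlice_subset hc x)
  refine IsCompact.image ?_ continuous_planePart
  exact hc.isCompact.inter_right
    (isClosed_eq (EuclideanSpace.proj (𝕜 := ℝ) (0 : Fin 3)).continuous continuous_const)

lemma partialDeriv_planeSlice (hψ : ContDiff ℝ ∞ ψ) (x : ℝ) (i : Fin 2) (q : Plane) :
    partialDeriv i (planeSlice ψ x) q = planeSlice (partialDeriv i.succ ψ) x q := by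
  have hd : HasFDerivAt (joinPoint x) (fderiv ℝ (joinPoint x) q) q :=
    ((contDiff_joinPoint_right x).differentiable (by simp) q).hasFDerivAt
  -- The derivative of the affine map `joinPoint x` in a coordinate direction is found twice, from
  -- the explicit line and from the chain rule; uniqueness identifies the two.
  have hl : HasDerivAt (fun t : ℝ => joinPoint x (q + t • EuclideanSpace.single i 1))
      (EuclideanSpace.single i.succ 1) 0 := by
    have h : (fun t : ℝ => joinPoint x (q + t • EuclideanSpace.single i 1)) =
        fun t : ℝ => joinPoint x q + t • EuclideanSpace.single i.succ (1 : ℝ) := by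
      funext t
      ext j
      fin_cases i <;> fin_cases j <;> simp [joinPoint]
    rw [h]
    simpa using ((hasDerivAt_id (0 : ℝ)).smul_const
      (EuclideanSpace.single i.succ (1 : ℝ))).const_add (joinPoint x q)
  have hl' : HasDerivAt (fun t : ℝ => joinPoint x (q + t • EuclideanSpace.single i 1))
      (fderiv ℝ (joinPoint x) q (EuclideanSpace.single i 1)) 0 := by
    have h1 : HasDerivAt (fun t : ℝ => q + t • EuclideanSpace.single i (1 : ℝ))
        (EuclideanSpace.single i 1) 0 := by
      simpa using ((hasDerivAt_id (0 : ℝ)).smul_const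
        (EuclideanSpace.single i (1 : ℝ))).const_add q
    have h2 : HasFDerivAt (joinPoint x) (fderiv ℝ (joinPoint x) q)
        (q + (0 : ℝ) • EuclideanSpace.single i (1 : ℝ)) := by simpa using hd
    exact h2.comp_hasDerivAt 0 h1
  have hψd : HasFDerivAt ψ (fderiv ℝ ψ (joinPoint x q)) (joinPoint x q) :=
    (hψ.differentiable (by simp) _).hasFDerivAt
  have hs : fderiv ℝ (planeSlice ψ x) q = (fderiv ℝ ψ (joinPoint x q)).comp
      (fderiv ℝ (joinPoint x) q) := (hψd.comp q hd).fderiv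
  unfold partialDeriv
  rw [hs, ContinuousLinearMap.comp_apply, hl'.unique hl]
  rfl

lemma hasDerivAt_joinPoint (hψ : ContDiff ℝ ∞ ψ) (x : ℝ) (q : Plane) :
    HasDerivAt (fun t => ψ (joinPoint t q)) (partialDeriv 0 ψ (joinPoint x q)) x :=
  ((hψ.differentiable (by simp) _).hasFDerivAt).comp_hasDerivAt x (hasDerivAt_joinPoint_left x q)

end Slices

/-! ### Fields with separated variables -/

section Separated

variable {a : ℝ} {U : TopologicalSpace.Opens Plane}

lemma preimage_spaceEquiv (a : ℝ) (U : TopologicalSpace.Opens Plane) :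
    spaceEquiv ⁻¹' (Set.Ioo 0 a ×ˢ (U : Set Plane)) = (productGuide a U : Set Space) := by
  ext p
  rw [Set.mem_preimage, spaceEquiv_apply]
  rfl

lemma mem_productGuide_iff {p : Space} :
    p ∈ (productGuide a U : Set Space) ↔ p 0 ∈ Set.Ioo 0 a ∧ planePart p ∈ (U : Set Plane) :=
  Iff.rfl

lemma measurePreserving_restrict_productGuide (a : ℝ) (U : TopologicalSpace.Opens Plane) :
    MeasurePreserving spaceEquiv (volume.restrict (productGuide a U : Set Space))
      ((volume.restrict (Set.Ioo 0 a)).prod (volume.restrict (U : Set Plane))) := by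
  rw [Measure.prod_restrict, ← preimage_spaceEquiv]
  exact measurePreserving_spaceEquiv.restrict_preimage_emb spaceEquiv.measurableEmbedding _

/-- The projection multiplies the measure by the length of the interval; null sets are all that
matters for pulling back classes of functions. -/
lemma quasiMeasurePreserving_planePart (a : ℝ) (U : TopologicalSpace.Opens Plane) :
    Measure.QuasiMeasurePreserving planePart (volume.restrict (productGuide a U : Set Space))
      (volume.restrict (U : Set Plane)) := by
  have h := Measure.quasiMeasurePreserving_snd.comp
    (measurePreserving_restrict_productGuide a U).quasiMeasurePreserving
  have he : Prod.snd ∘ spaceEquiv = planePart := by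
    funext p
    simp [spaceEquiv_apply]
  rwa [he] at h

lemma integral_productGuide {G : Type*} [NormedAddCommGroup G] [NormedSpace ℝ G] (f : Space → G) :
    ∫ p in (productGuide a U : Set Space), f p =
      ∫ z, f (joinPoint z.1 z.2)
        ∂((volume.restrict (Set.Ioo 0 a)).prod (volume.restrict (U : Set Plane))) := by
  rw [← (measurePreserving_restrict_productGuide a U).integral_comp']
  refine integral_congr_ae (Eventually.of_forall fun p => ?_)
  simp [spaceEquiv_apply, joinPoint_planePart]

lemma integrable_productGuide {G : Type*} [NormedAddCommGroup G] {f : Space → G} :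
    Integrable f (volume.restrict (productGuide a U : Set Space)) ↔
      Integrable (fun z : ℝ × Plane => f (joinPoint z.1 z.2))
        ((volume.restrict (Set.Ioo 0 a)).prod (volume.restrict (U : Set Plane))) := by
  rw [← (measurePreserving_restrict_productGuide a U).integrable_comp_emb
    spaceEquiv.measurableEmbedding]
  refine integrable_congr (Eventually.of_forall fun p => ?_)
  simp [spaceEquiv_apply, joinPoint_planePart]

lemma integrable_sq_norm_of_continuous {α : ℝ → ℝ} (hα : Continuous α) (a : ℝ) :
    Integrable (fun x => α x ^ 2) (volume.restrict (Set.Ioo 0 a)) :=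
  ((hα.pow 2).integrableOn_Icc (a := 0) (b := a)).mono_set Set.Ioo_subset_Icc_self

/-- The square of the norm is a product of integrable functions of `x` and of `(y, z)`, so Fubini
applies. -/
lemma memLp_separated {α : ℝ → ℝ} (hα : Continuous α) {u : Plane → ℂ}
    (hu : MemLp u 2 (volume.restrict (U : Set Plane))) :
    MemLp (fun p : Space => (α (p 0) : ℂ) * u (planePart p)) 2
      (volume.restrict (productGuide a U : Set Space)) := by
  have hm : AEStronglyMeasurable (fun p : Space => (α (p 0) : ℂ) * u (planePart p))
      (volume.restrict (productGuide a U : Set Space)) := by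
    refine AEStronglyMeasurable.mul ?_
      (hu.1.comp_quasiMeasurePreserving (quasiMeasurePreserving_planePart a U))
    exact (Complex.continuous_ofReal.comp (hα.comp
      (EuclideanSpace.proj (𝕜 := ℝ) (0 : Fin 3)).continuous)).aestronglyMeasurable
  rw [memLp_two_iff_integrable_sq_norm hm, integrable_productGuide]
  have h := (integrable_sq_norm_of_continuous hα a).mul_prod
    ((memLp_two_iff_integrable_sq_norm hu.1).1 hu)
  refine h.congr (Eventually.of_forall fun z => ?_)
  simp [mul_pow]

/-- The pairing of the separated function `α (x) u (y, z)` with a test function. -/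
def sepPairing (a : ℝ) (U : TopologicalSpace.Opens Plane) (α : ℝ → ℝ) (u : Plane → ℂ)
    (ψ : Space → ℝ) : ℂ :=
  ∫ p in (productGuide a U : Set Space), (α (p 0) : ℂ) * u (planePart p) * (ψ p : ℂ)

lemma integrable_separated {α : ℝ → ℝ} (hα : Continuous α) {u : Plane → ℂ}
    (hu : MemLp u 2 (volume.restrict (U : Set Plane))) {ψ : Space → ℝ} (hψ : Continuous ψ)
    (hc : HasCompactSupport ψ) :
    Integrable (fun p : Space => (α (p 0) : ℂ) * u (planePart p) * (ψ p : ℂ))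
      (volume.restrict (productGuide a U : Set Space)) := by
  have hc' : HasCompactSupport (fun p => (ψ p : ℂ)) :=
    hc.comp_left (g := fun r : ℝ => (r : ℂ)) (by simp)
  have hm : MemLp (fun p => (ψ p : ℂ)) 2 (volume.restrict (productGuide a U : Set Space)) :=
    (Complex.continuous_ofReal.comp hψ).memLp_of_hasCompactSupport hc'
  exact (memLp_separated hα hu).integrable_mul hm

variable {α : ℝ → ℝ} {u : Plane → ℂ} {ψ ψ' : Space → ℝ}

lemma sepPairing_sub (hα : Continuous α) (hu : MemLp u 2 (volume.restrict (U : Set Plane)))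
    (hψ : Continuous ψ) (hc : HasCompactSupport ψ) (hψ' : Continuous ψ')
    (hc' : HasCompactSupport ψ') :
    sepPairing a U α u (fun p => ψ p - ψ' p) = sepPairing a U α u ψ - sepPairing a U α u ψ' := by
  unfold sepPairing
  rw [← integral_sub (integrable_separated hα hu hψ hc) (integrable_separated hα hu hψ' hc')]
  refine integral_congr_ae (Eventually.of_forall fun p => ?_)
  simp only [Complex.ofReal_sub]
  ring

lemma sepPairing_const_mul (c : ℝ) :
    sepPairing a U (fun x => c * α x) u ψ = c * sepPairing a U α u ψ := by
  unfold sepPairing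
  rw [← integral_const_mul]
  refine integral_congr_ae (Eventually.of_forall fun p => ?_)
  simp only [Complex.ofReal_mul]
  ring

lemma sepPairing_const_mul_left (c : ℂ) :
    sepPairing a U α (fun q => c * u q) ψ = c * sepPairing a U α u ψ := by
  unfold sepPairing
  rw [← integral_const_mul]
  refine integral_congr_ae (Eventually.of_forall fun p => ?_)
  simp only
  ring

/-- Fubini with the transverse integral inside: a weak identity in the plane, tested on each slice,
then integrates to one in the guide. -/
lemma sepPairing_eq_integral_planeSlice (hα : Continuous α)
    (hu : MemLp u 2 (volume.restrict (U : Set Plane)))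
    (hψ : Continuous ψ) (hc : HasCompactSupport ψ) :
    sepPairing a U α u ψ = ∫ x in Set.Ioo 0 a,
      (α x : ℂ) * ∫ q in (U : Set Plane), u q * (planeSlice ψ x q : ℂ) := by
  unfold sepPairing
  have hi := integrable_productGuide.1 (integrable_separated (a := a) hα hu hψ hc)
  rw [integral_productGuide, integral_prod _ hi]
  refine integral_congr_ae (Eventually.of_forall fun x => ?_)
  simp only
  rw [← integral_const_mul]
  refine integral_congr_ae (Eventually.of_forall fun q => ?_)
  simp [planeSlice, mul_assoc]

lemma integrable_integral_planeSlice (hα : Continuous α)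
    (hu : MemLp u 2 (volume.restrict (U : Set Plane)))
    (hψ : Continuous ψ) (hc : HasCompactSupport ψ) :
    Integrable (fun x => (α x : ℂ) * ∫ q in (U : Set Plane), u q * (planeSlice ψ x q : ℂ))
      (volume.restrict (Set.Ioo 0 a)) := by
  have hi := integrable_productGuide.1 (integrable_separated (a := a) hα hu hψ hc)
  refine hi.integral_prod_left.congr (Eventually.of_forall fun x => ?_)
  simp only
  rw [← integral_const_mul]
  refine integral_congr_ae (Eventually.of_forall fun q => ?_)
  simp [planeSlice, mul_assoc]

/-- Integration by parts in the longitudinal variable. -/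
lemma sepPairing_partialDeriv_zero (ha : 0 < a) {α' : ℝ → ℝ} (hα : ∀ x, HasDerivAt α (α' x) x)
    (hα' : Continuous α') (hu : MemLp u 2 (volume.restrict (U : Set Plane)))
    (hψ : ContDiff ℝ ∞ ψ) (hc : HasCompactSupport ψ)
    (hb : ∀ q ∈ U, α 0 * ψ (joinPoint 0 q) = 0 ∧ α a * ψ (joinPoint a q) = 0) :
    sepPairing a U α u (partialDeriv 0 ψ) = -sepPairing a U α' u ψ := by
  have hαc : Continuous α := continuous_iff_continuousAt.2 fun x => (hα x).continuousAt
  have hi := integrable_productGuide.1 (integrable_separated (a := a) hαc hu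
    (continuous_partialDeriv hψ 0) (hasCompactSupport_partialDeriv hc 0))
  have hi' := integrable_productGuide.1 (integrable_separated (a := a) hα' hu hψ.continuous hc)
  unfold sepPairing
  rw [integral_productGuide, integral_productGuide, integral_prod_symm _ hi,
    integral_prod_symm _ hi', ← integral_neg]
  refine setIntegral_congr_fun U.isOpen.measurableSet fun q hq => ?_
  -- One-dimensional integration by parts on `(0, a)`. By `hb` the end terms vanish, whether it is
  -- the mode or the test function that is zero there.
  have hkey : ∫ x in Set.Ioo 0 a, α x * partialDeriv 0 ψ (joinPoint x q) =
      -∫ x in Set.Ioo 0 a, α' x * ψ (joinPoint x q) := by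
    have hj : Continuous fun x => joinPoint x q :=
      continuous_iff_continuousAt.2 fun x => (hasDerivAt_joinPoint_left x q).continuousAt
    have h := intervalIntegral.integral_mul_deriv_eq_deriv_mul (a := 0) (b := a)
      (fun x _ => hα x) (fun x _ => hasDerivAt_joinPoint hψ x q)
      (hα'.intervalIntegrable _ _)
      (((continuous_partialDeriv hψ 0).comp hj).intervalIntegrable _ _)
    rw [(hb q hq).1, (hb q hq).2, intervalIntegral.integral_of_le ha.le,
      intervalIntegral.integral_of_le ha.le, integral_Ioc_eq_integral_Ioo,
      integral_Ioc_eq_integral_Ioo] at h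
    simpa using h
  have hcast : ∀ β χ : ℝ → ℝ, ∫ x in Set.Ioo 0 a, (β x : ℂ) * u q * (χ x : ℂ) =
      u q * ((∫ x in Set.Ioo 0 a, β x * χ x : ℝ) : ℂ) := by
    intro β χ
    rw [← integral_complex_ofReal, ← integral_const_mul]
    refine integral_congr_ae (Eventually.of_forall fun x => ?_)
    simp only [Complex.ofReal_mul]
    ring
  simp only [joinPoint_zero, planePart_joinPoint]
  rw [hcast, hcast, hkey]
  simp

end Separated

/-! ### Plane fields and their weak derivatives -/

section PlaneFields

lemma contDiff_partialDeriv {n : ℕ} {f : EuclideanSpace ℝ (Fin n) → ℝ} (hf : ContDiff ℝ ∞ f)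
    (i : Fin n) : ContDiff ℝ ∞ (partialDeriv i f) :=
  (hf.fderiv_right (m := ∞) (by simp)).clm_apply contDiff_const

lemma tsupport_partialDeriv_subset {n : ℕ} (f : EuclideanSpace ℝ (Fin n) → ℝ) (i : Fin n) :
    tsupport (partialDeriv i f) ⊆ tsupport f := by
  refine closure_minimal (fun p hp => support_fderiv_subset ℝ (f := f) ?_) (isClosed_tsupport f)
  intro h
  exact hp (by simp [partialDeriv, h])

lemma partialDeriv_swap {n : ℕ} {f : EuclideanSpace ℝ (Fin n) → ℝ} (hf : ContDiff ℝ ∞ f)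
    (i j : Fin n) : partialDeriv i (partialDeriv j f) = partialDeriv j (partialDeriv i f) := by
  funext p
  have hd : DifferentiableAt ℝ (fderiv ℝ f) p :=
    ((hf.fderiv_right (m := ∞) (by simp)).differentiable (by simp)) p
  have key : ∀ k l : Fin n, partialDeriv k (partialDeriv l f) p =
      fderiv ℝ (fderiv ℝ f) p (EuclideanSpace.single k 1) (EuclideanSpace.single l 1) := by
    intro k l
    unfold partialDeriv
    rw [fderiv_clm_apply hd (by fun_prop)]
    simp
  have hs : IsSymmSndFDerivAt ℝ f p := by
    refine hf.contDiffAt.isSymmSndFDerivAt ?_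
    simp only [minSmoothness_of_isRCLikeNormedField]
    exact WithTop.coe_le_coe.2 le_top
  rw [key, key]
  exact hs _ _

variable {U : TopologicalSpace.Opens Plane}

/-- Square integrable complex fields on the plane domain `U`. -/
abbrev PlaneL2 (U : TopologicalSpace.Opens Plane) :=
  Lp (EuclideanSpace ℂ (Fin 2)) 2 (volume.restrict (U : Set Plane))

/-- The field `g` satisfies `-div g = w` in `U` and `g · n = 0` on `∂U`, in the weak sense. -/
def HasNeumannDivergence (g : PlaneL2 U) (w : Lp ℂ 2 (volume.restrict (U : Set Plane))) : Prop :=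
  ∀ ψ : Plane → ℝ, ContDiff ℝ ∞ ψ → HasCompactSupport ψ →
    (∫ p in (U : Set Plane), g p 0 * (partialDeriv 0 ψ p : ℂ)) +
      (∫ p in (U : Set Plane), g p 1 * (partialDeriv 1 ψ p : ℂ)) =
        ∫ p in (U : Set Plane), w p * (ψ p : ℂ)

/-- The scalar curl of the plane field `g` vanishes in `U` in the sense of distributions. -/
def IsPlaneCurlFree (g : PlaneL2 U) : Prop :=
  ∀ ψ : Plane → ℝ, ContDiff ℝ ∞ ψ → HasCompactSupport ψ → tsupport ψ ⊆ (U : Set Plane) →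
    (∫ p in (U : Set Plane), g p 1 * (partialDeriv 0 ψ p : ℂ)) =
      ∫ p in (U : Set Plane), g p 0 * (partialDeriv 1 ψ p : ℂ)

/-- Testing the weak gradient against `∂₀ψ` and `∂₁ψ` moves every derivative onto `ψ`, where the
second derivatives commute. -/
lemma IsWeakGradient.isPlaneCurlFree {φ : Lp ℂ 2 (volume.restrict (U : Set Plane))}
    {g : PlaneL2 U} (h : IsWeakGradient φ g) : IsPlaneCurlFree g := by
  intro ψ h1 h2 h3
  have h0 := fun i j => h (partialDeriv i ψ) (contDiff_partialDeriv h1 i)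
    (hasCompactSupport_partialDeriv h2 i) ((tsupport_partialDeriv_subset ψ i).trans h3) j
  have e := h0 0 1
  rw [partialDeriv_swap h1 1 0, h0 1 0] at e
  exact (neg_injective e).symm

lemma memLp_planeCoord (g : PlaneL2 U) (i : Fin 2) :
    MemLp (fun p => g p i) 2 (volume.restrict (U : Set Plane)) :=
  (Lp.memLp g).continuousLinearMap_comp (EuclideanSpace.proj (𝕜 := ℂ) i)

end PlaneFields

/-! ### The longitudinal modes -/

section Modes

/-- The Dirichlet mode `sin (m π x / a)` of the interval `(0, a)`. -/
def sinMode (a : ℝ) (m : ℕ) (x : ℝ) : ℝ := Real.sin (m * Real.pi * x / a)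

/-- The wave number `m π / a`. -/
def waveNumber (a : ℝ) (m : ℕ) : ℝ := m * Real.pi / a

/-- The derivative of `sinMode`. -/
def cosMode (a : ℝ) (m : ℕ) (x : ℝ) : ℝ := waveNumber a m * Real.cos (m * Real.pi * x / a)

variable (a : ℝ) (m : ℕ)

lemma hasDerivAt_phase (x : ℝ) :
    HasDerivAt (fun x : ℝ => m * Real.pi * x / a) (waveNumber a m) x := by
  simpa [waveNumber] using ((hasDerivAt_id x).const_mul (m * Real.pi)).div_const a

lemma hasDerivAt_sinMode (x : ℝ) : HasDerivAt (sinMode a m) (cosMode a m x) x := by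
  have h := (hasDerivAt_phase a m x).sin
  rwa [mul_comm (Real.cos _)] at h

lemma hasDerivAt_cosMode (x : ℝ) :
    HasDerivAt (cosMode a m) (-(waveNumber a m ^ 2) * sinMode a m x) x := by
  have h := (hasDerivAt_phase a m x).cos.const_mul (waveNumber a m)
  refine h.congr_deriv ?_
  unfold sinMode
  ring

lemma continuous_sinMode : Continuous (sinMode a m) :=
  continuous_iff_continuousAt.2 fun x => (hasDerivAt_sinMode a m x).continuousAt

lemma continuous_cosMode : Continuous (cosMode a m) :=
  continuous_iff_continuousAt.2 fun x => (hasDerivAt_cosMode a m x).continuousAt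

lemma sinMode_zero : sinMode a m 0 = 0 := by simp [sinMode]

variable {a} in
lemma sinMode_self (ha : 0 < a) : sinMode a m a = 0 := by
  rw [sinMode, mul_div_assoc, div_self ha.ne', mul_one, Real.sin_nat_mul_pi]

/-- The integral of the square of the longitudinal mode. -/
def sinModeMass : ℝ := ∫ x in Set.Ioo 0 a, sinMode a m x ^ 2

variable {a m} in
lemma sinModeMass_pos (ha : 0 < a) (hm : 1 ≤ m) : 0 < sinModeMass a m := by
  have hm' : (1 : ℝ) ≤ m := by exact_mod_cast hm
  unfold sinModeMass
  rw [integral_pos_iff_support_of_nonneg (fun x => sq_nonneg _)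
    (integrable_sq_norm_of_continuous (continuous_sinMode a m) a),
    Measure.restrict_apply' measurableSet_Ioo]
  -- On the first arch of the sine, before its first positive zero `a / m`, the mode is positive;
  -- this is where `m ≥ 1` enters.
  have hsub : Set.Ioo 0 (a / m) ⊆
      Function.support (fun x => sinMode a m x ^ 2) ∩ Set.Ioo 0 a := by
    rintro x ⟨h0, h1⟩
    have hxa : x * m < a := by rwa [lt_div_iff₀ (by linarith)] at h1
    refine ⟨?_, h0, by nlinarith⟩
    have hp : 0 < sinMode a m x := by
      refine Real.sin_pos_of_pos_of_lt_pi (by positivity) ?_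
      rw [div_lt_iff₀ ha]
      nlinarith [Real.pi_pos]
    exact (pow_pos hp 2).ne'
  refine lt_of_lt_of_le ?_ (measure_mono hsub)
  rw [Real.volume_Ioo, ENNReal.ofReal_pos]
  have : 0 < a / m := by positivity
  linarith

end Modes

/-! ### The trapped fields and their curls -/

section Trapped

variable {a : ℝ} {U : TopologicalSpace.Opens Plane}

/-- The field with components `α i (x) u i (y, z)`. -/
def separatedField (α : Fin 3 → ℝ → ℝ) (u : Fin 3 → Plane → ℂ) (p : Space) :
    EuclideanSpace ℂ (Fin 3) :=
  WithLp.toLp 2 fun i => (α i (p 0) : ℂ) * u i (planePart p)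

lemma memLp_separatedField {α : Fin 3 → ℝ → ℝ} (hα : ∀ i, Continuous (α i))
    {u : Fin 3 → Plane → ℂ} (hu : ∀ i, MemLp (u i) 2 (volume.restrict (U : Set Plane))) :
    MemLp (separatedField α u) 2 (volume.restrict (productGuide a U : Set Space)) :=
  MemLp.of_eval_piLp fun i => memLp_separated (hα i) (hu i)

lemma pairing_eq_of_separated {α : Fin 3 → ℝ → ℝ} (hα : ∀ i, Continuous (α i))
    {u : Fin 3 → Plane → ℂ} (hu : ∀ i, MemLp (u i) 2 (volume.restrict (U : Set Plane)))
    {E : VecL2 (productGuide a U)}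
    (hE : E =ᵐ[volume.restrict (productGuide a U : Set Space)] separatedField α u)
    {Φ : Space → Space} (hΦ : IsTestField Φ) :
    pairing (productGuide a U) E Φ = sepPairing a U (α 0) (u 0) (fun p => Φ p 0) +
      sepPairing a U (α 1) (u 1) (fun p => Φ p 1) +
      sepPairing a U (α 2) (u 2) (fun p => Φ p 2) := by
  rw [← Fin.sum_univ_three (fun i => sepPairing a U (α i) (u i) (fun p => Φ p i))]
  unfold sepPairing pairing
  rw [← integral_finsetSum _ fun i _ => integrable_separated (hα i) (hu i) (hΦ i).1 (hΦ i).2]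
  refine integral_congr_ae ?_
  filter_upwards [hE] with p hp
  simp [hp, separatedField]

/-- The transverse components of the trapped field. -/
def transverse (g : Plane → EuclideanSpace ℂ (Fin 2)) : Fin 3 → Plane → ℂ :=
  ![0, fun q => g q 1, fun q => -g q 0]

lemma trappedField_eq (a : ℝ) (m : ℕ) (g : Plane → EuclideanSpace ℂ (Fin 2)) :
    trappedField a m g = separatedField (fun _ => sinMode a m) (transverse g) := by
  funext p
  ext i
  fin_cases i <;> simp [trappedField, separatedField, transverse, sinMode, planePart]

lemma memLp_transverse (g : PlaneL2 U) (i : Fin 3) :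
    MemLp (transverse g i) 2 (volume.restrict (U : Set Plane)) := by
  fin_cases i
  · exact MemLp.zero
  · exact memLp_planeCoord g 1
  · exact (memLp_planeCoord g 0).neg

lemma memLp_trappedField (a : ℝ) (m : ℕ) (g : PlaneL2 U) :
    MemLp (trappedField a m g) 2 (volume.restrict (productGuide a U : Set Space)) := by
  rw [trappedField_eq]
  exact memLp_separatedField (fun _ => continuous_sinMode a m) (memLp_transverse g)

lemma trappedField_congr (a : ℝ) (m : ℕ) {g g' : Plane → EuclideanSpace ℂ (Fin 2)}
    (h : g =ᵐ[volume.restrict (U : Set Plane)] g') :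
    trappedField a m g =ᵐ[volume.restrict (productGuide a U : Set Space)] trappedField a m g' := by
  filter_upwards [(quasiMeasurePreserving_planePart a U).ae_eq_comp h] with p hp
  have hp' : g !₂[p 1, p 2] = g' !₂[p 1, p 2] := hp
  simp only [trappedField, hp']

/-- The map that sends a plane field to the corresponding trapped field. -/
def trappedLp (a : ℝ) (m : ℕ) (U : TopologicalSpace.Opens Plane) :
    PlaneL2 U →ₗ[ℂ] VecL2 (productGuide a U) where
  toFun g := (memLp_trappedField a m g).toLp _
  map_add' g g' := by
    rw [← MemLp.toLp_add, MemLp.toLp_eq_toLp_iff]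
    refine (trappedField_congr a m (Lp.coeFn_add g g')).trans (Eventually.of_forall fun p => ?_)
    ext i
    fin_cases i <;> simp [trappedField] <;> ring
  map_smul' c g := by
    rw [RingHom.id_apply, ← MemLp.toLp_const_smul, MemLp.toLp_eq_toLp_iff]
    refine (trappedField_congr a m (Lp.coeFn_smul c g)).trans (Eventually.of_forall fun p => ?_)
    ext i
    fin_cases i <;> simp [trappedField] <;> ring

lemma coeFn_trappedLp (a : ℝ) (m : ℕ) (g : PlaneL2 U) :
    trappedLp a m U g =ᵐ[volume.restrict (productGuide a U : Set Space)] trappedField a m g :=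
  MemLp.coeFn_toLp (memLp_trappedField a m g)

lemma norm_sq_lp {X : Type*} [MeasurableSpace X] {μ : Measure X} {n : ℕ}
    (f : Lp (EuclideanSpace ℂ (Fin n)) 2 μ) : ‖f‖ ^ 2 = ∫ x, ‖f x‖ ^ 2 ∂μ := by
  have h : (inner ℂ f f : ℂ) = ((∫ x, ‖f x‖ ^ 2 ∂μ : ℝ) : ℂ) := by
    rw [L2.inner_def, ← integral_complex_ofReal]
    refine integral_congr_ae (Eventually.of_forall fun x => ?_)
    simp [inner_self_eq_norm_sq_to_K]
  rw [inner_self_eq_norm_sq_to_K] at h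
  exact Complex.ofReal_injective ((Complex.ofReal_pow _ _).trans h)

/-- The lift rotates `g` by a right angle and multiplies it by the sine, so the squared norms factor
by Fubini. Up to a constant the lift is thus an isometry, which carries orthonormal plane fields to
orthonormal fields of the guide. -/
lemma norm_sq_trappedLp (a : ℝ) (m : ℕ) (g : PlaneL2 U) :
    ‖trappedLp a m U g‖ ^ 2 = sinModeMass a m * ‖g‖ ^ 2 := by
  rw [norm_sq_lp, norm_sq_lp, sinModeMass, ← integral_prod_mul]
  have h : ∫ p in (productGuide a U : Set Space), ‖trappedLp a m U g p‖ ^ 2 =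
      ∫ p in (productGuide a U : Set Space), ‖trappedField a m g p‖ ^ 2 := by
    refine integral_congr_ae ?_
    filter_upwards [coeFn_trappedLp a m g] with p hp
    rw [hp]
  rw [h, integral_productGuide]
  refine integral_congr_ae (Eventually.of_forall fun z => ?_)
  rw [trappedField_eq]
  simp only [EuclideanSpace.norm_sq_eq, Fin.sum_univ_three, Fin.sum_univ_two, separatedField,
    transverse, joinPoint_zero, planePart_joinPoint]
  simp [mul_pow]
  ring

/-- The trapped fields, normalized into an isometric embedding. -/
def trappedIsometry {a : ℝ} {m : ℕ} (ha : 0 < a) (hm : 1 ≤ m) (U : TopologicalSpace.Opens Plane) :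
    PlaneL2 U →ₗᵢ[ℂ] VecL2 (productGuide a U) where
  toLinearMap := (((Real.sqrt (sinModeMass a m))⁻¹ : ℝ) : ℂ) • trappedLp a m U
  norm_map' g := by
    have hs := sinModeMass_pos ha hm
    refine (sq_eq_sq₀ (norm_nonneg _) (norm_nonneg _)).1 ?_
    rw [LinearMap.smul_apply, norm_smul, mul_pow, norm_sq_trappedLp, Complex.norm_real,
      Real.norm_eq_abs, sq_abs, inv_pow, Real.sq_sqrt hs.le]
    field_simp

variable {m : ℕ}

lemma sepPairing_congr_planeSlice {α : ℝ → ℝ} (hα : Continuous α) {u v : Plane → ℂ}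
    (hu : MemLp u 2 (volume.restrict (U : Set Plane)))
    (hv : MemLp v 2 (volume.restrict (U : Set Plane))) {ψ χ : Space → ℝ}
    (hψ : Continuous ψ) (hψc : HasCompactSupport ψ) (hχ : Continuous χ)
    (hχc : HasCompactSupport χ)
    (h : ∀ x, ∫ q in (U : Set Plane), u q * (planeSlice ψ x q : ℂ) =
      ∫ q in (U : Set Plane), v q * (planeSlice χ x q : ℂ)) :
    sepPairing a U α u ψ = sepPairing a U α v χ := by
  rw [sepPairing_eq_integral_planeSlice hα hu hψ hψc,
    sepPairing_eq_integral_planeSlice hα hv hχ hχc]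
  simp only [h]

/-! ### Plane identities transferred to the guide slice by slice -/

section Slicewise

variable {α : ℝ → ℝ} {ψ : Space → ℝ}

lemma HasNeumannDivergence.sepPairing {g : PlaneL2 U}
    {w : Lp ℂ 2 (volume.restrict (U : Set Plane))} (h : HasNeumannDivergence g w)
    (hα : Continuous α) (hψ : ContDiff ℝ ∞ ψ) (hc : HasCompactSupport ψ) :
    MaxwellGuide.sepPairing a U α (fun q => g q 0) (partialDeriv 1 ψ) +
      MaxwellGuide.sepPairing a U α (fun q => g q 1) (partialDeriv 2 ψ) =
        MaxwellGuide.sepPairing a U α w ψ := by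
  have hd := fun i => continuous_partialDeriv hψ i
  have hdc := fun i => hasCompactSupport_partialDeriv hc i
  rw [sepPairing_eq_integral_planeSlice hα (memLp_planeCoord g 0) (hd 1) (hdc 1),
    sepPairing_eq_integral_planeSlice hα (memLp_planeCoord g 1) (hd 2) (hdc 2),
    sepPairing_eq_integral_planeSlice hα (Lp.memLp w) hψ.continuous hc,
    ← integral_add (integrable_integral_planeSlice hα (memLp_planeCoord g 0) (hd 1) (hdc 1))
      (integrable_integral_planeSlice hα (memLp_planeCoord g 1) (hd 2) (hdc 2))]
  refine integral_congr_ae (Eventually.of_forall fun x => ?_)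
  have hx := h (planeSlice ψ x) (contDiff_planeSlice hψ x) (hasCompactSupport_planeSlice hc x)
  simp only [partialDeriv_planeSlice hψ] at hx
  simp only [← hx, mul_add]
  rfl

lemma tsupport_planeSlice_subset_domain (hc : HasCompactSupport ψ)
    (hs : tsupport ψ ⊆ (productGuide a U : Set Space)) (x : ℝ) :
    tsupport (planeSlice ψ x) ⊆ (U : Set Plane) := by
  refine (tsupport_planeSlice_subset hc x).trans ?_
  rintro _ ⟨p, ⟨hp, -⟩, rfl⟩
  exact (mem_productGuide_iff.1 (hs hp)).2

lemma IsPlaneCurlFree.sepPairing {g : PlaneL2 U} (h : IsPlaneCurlFree g)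
    (hα : Continuous α) (hψ : ContDiff ℝ ∞ ψ) (hc : HasCompactSupport ψ)
    (hs : tsupport ψ ⊆ (productGuide a U : Set Space)) :
    MaxwellGuide.sepPairing a U α (fun q => g q 1) (partialDeriv 1 ψ) =
      MaxwellGuide.sepPairing a U α (fun q => g q 0) (partialDeriv 2 ψ) := by
  refine sepPairing_congr_planeSlice hα (memLp_planeCoord g 1) (memLp_planeCoord g 0)
    (continuous_partialDeriv hψ 1) (hasCompactSupport_partialDeriv hc 1)
    (continuous_partialDeriv hψ 2) (hasCompactSupport_partialDeriv hc 2) fun x => ?_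
  have hx := h (planeSlice ψ x) (contDiff_planeSlice hψ x) (hasCompactSupport_planeSlice hc x)
    (tsupport_planeSlice_subset_domain hc hs x)
  simp only [partialDeriv_planeSlice hψ] at hx
  exact hx

lemma IsWeakGradient.sepPairing {w : Lp ℂ 2 (volume.restrict (U : Set Plane))} {v : PlaneL2 U}
    (h : IsWeakGradient w v) (hα : Continuous α) (hψ : ContDiff ℝ ∞ ψ) (hc : HasCompactSupport ψ)
    (hs : tsupport ψ ⊆ (productGuide a U : Set Space)) (i : Fin 2) :
    MaxwellGuide.sepPairing a U α w (partialDeriv i.succ ψ) =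
      -MaxwellGuide.sepPairing a U α (fun q => v q i) ψ := by
  rw [← neg_one_mul, ← sepPairing_const_mul_left]
  refine sepPairing_congr_planeSlice hα (Lp.memLp w) ((memLp_planeCoord v i).const_mul (-1))
    (continuous_partialDeriv hψ _) (hasCompactSupport_partialDeriv hc _)
    hψ.continuous hc fun x => ?_
  have hx := h (planeSlice ψ x) (contDiff_planeSlice hψ x) (hasCompactSupport_planeSlice hc x)
    (tsupport_planeSlice_subset_domain hc hs x) i
  simp only [partialDeriv_planeSlice hψ] at hx
  rw [hx, ← integral_neg]
  simp

end Slicewise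

lemma pairing_trappedLp (g : PlaneL2 U) {Φ : Space → Space} (hΦ : IsTestField Φ) :
    pairing (productGuide a U) (trappedLp a m U g) Φ =
      sepPairing a U (sinMode a m) (fun q => g q 1) (fun p => Φ p 1) -
        sepPairing a U (sinMode a m) (fun q => g q 0) (fun p => Φ p 2) := by
  have h := coeFn_trappedLp a m g
  rw [trappedField_eq] at h
  rw [pairing_eq_of_separated (fun _ => continuous_sinMode a m) (memLp_transverse g) h hΦ]
  have h0 : sepPairing a U (sinMode a m) (transverse g 0) (fun p => Φ p 0) = 0 := by
    simp [sepPairing, transverse]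
  have h2 : sepPairing a U (sinMode a m) (transverse g 2) (fun p => Φ p 2) =
      -sepPairing a U (sinMode a m) (fun q => g q 0) (fun p => Φ p 2) := by
    rw [← neg_one_mul, ← sepPairing_const_mul_left]
    simp [transverse]
  have h1 : sepPairing a U (sinMode a m) (transverse g 1) (fun p => Φ p 1) =
      sepPairing a U (sinMode a m) (fun q => g q 1) (fun p => Φ p 1) := rfl
  rw [h0, h1, h2]
  ring

/-- The divergence of the lift is the sine times the scalar curl of `g`. -/
lemma isDivFree_trappedLp {g : PlaneL2 U} (h : IsPlaneCurlFree g) :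
    IsDivFree (trappedLp a m U g) := by
  intro ψ h1 h2 h3
  rw [pairing_trappedLp g (isTestField_of_smooth (contDiff_grad h1) (hasCompactSupport_grad h2))]
  exact sub_eq_zero.2 (h.sepPairing (continuous_sinMode a m) h1 h2 h3)

/-- The magnetic field that corresponds to a trapped electric field. -/
def trappedCurl (a : ℝ) (m : ℕ) (w : Plane → ℂ) (g : Plane → EuclideanSpace ℂ (Fin 2)) :
    Space → EuclideanSpace ℂ (Fin 3) :=
  separatedField ![sinMode a m, cosMode a m, cosMode a m] ![w, fun q => g q 0, fun q => g q 1]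

lemma continuous_trappedCurl_modes (a : ℝ) (m : ℕ) (i : Fin 3) :
    Continuous ((![sinMode a m, cosMode a m, cosMode a m] : Fin 3 → ℝ → ℝ) i) := by
  fin_cases i
  · exact continuous_sinMode a m
  · exact continuous_cosMode a m
  · exact continuous_cosMode a m

lemma memLp_trappedCurl_components (w : Lp ℂ 2 (volume.restrict (U : Set Plane))) (g : PlaneL2 U)
    (i : Fin 3) : MemLp ((![w, fun q => g q 0, fun q => g q 1] : Fin 3 → Plane → ℂ) i) 2
      (volume.restrict (U : Set Plane)) := by
  fin_cases i
  · exact Lp.memLp w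
  · exact memLp_planeCoord g 0
  · exact memLp_planeCoord g 1

/-- The class of `trappedCurl`. -/
def trappedCurlLp (a : ℝ) (m : ℕ) (w : Lp ℂ 2 (volume.restrict (U : Set Plane)))
    (g : PlaneL2 U) : VecL2 (productGuide a U) :=
  (memLp_separatedField (a := a) (continuous_trappedCurl_modes a m)
    (memLp_trappedCurl_components w g)).toLp (trappedCurl a m w g)

lemma pairing_trappedCurlLp (w : Lp ℂ 2 (volume.restrict (U : Set Plane))) (g : PlaneL2 U)
    {Φ : Space → Space} (hΦ : IsTestField Φ) :
    pairing (productGuide a U) (trappedCurlLp a m w g) Φ =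
      sepPairing a U (sinMode a m) w (fun p => Φ p 0) +
        sepPairing a U (cosMode a m) (fun q => g q 0) (fun p => Φ p 1) +
        sepPairing a U (cosMode a m) (fun q => g q 1) (fun p => Φ p 2) :=
  pairing_eq_of_separated (continuous_trappedCurl_modes a m) (memLp_trappedCurl_components w g)
    (MemLp.coeFn_toLp _) hΦ

/-- Since `Φ` need not vanish on the boundary, this one Green formula gives both the weak curl and
the zero tangential trace. The transverse terms combine into `-div g`, with no flux through `∂U`;
the longitudinal ones turn the sine into its derivative. -/
lemma pairing_trappedLp_curl (ha : 0 < a) {g : PlaneL2 U}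
    {w : Lp ℂ 2 (volume.restrict (U : Set Plane))} (h : HasNeumannDivergence g w)
    {Φ : Space → Space} (hΦ : ContDiff ℝ ∞ Φ) (hc : HasCompactSupport Φ) :
    pairing (productGuide a U) (trappedLp a m U g) (curl Φ) =
      pairing (productGuide a U) (trappedCurlLp a m w g) Φ := by
  have hs := continuous_sinMode a m
  have hd := fun i j => continuous_partialDeriv (contDiff_coord hΦ i) j
  have hdc := fun i j => hasCompactSupport_partialDeriv (hasCompactSupport_coord hc i) j
  rw [pairing_trappedLp g (isTestField_curl hΦ hc),
    pairing_trappedCurlLp w g (isTestField_of_smooth hΦ hc)]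
  have e1 : sepPairing a U (sinMode a m) (fun q => g q 1) (fun p => curl Φ p 1) = _ :=
    sepPairing_sub hs (memLp_planeCoord g 1) (hd 0 2) (hdc 0 2) (hd 2 0) (hdc 2 0)
  have e2 : sepPairing a U (sinMode a m) (fun q => g q 0) (fun p => curl Φ p 2) = _ :=
    sepPairing_sub hs (memLp_planeCoord g 0) (hd 1 0) (hdc 1 0) (hd 0 1) (hdc 0 1)
  -- The sine vanishes at `0` and at `a`, so no condition on `Φ` at the end faces is needed.
  have hx : ∀ i j, sepPairing a U (sinMode a m) (fun q => g q i)
      (partialDeriv 0 fun p => Φ p j) = -sepPairing a U (cosMode a m) (fun q => g q i)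
        (fun p => Φ p j) := fun i j =>
    sepPairing_partialDeriv_zero ha (hasDerivAt_sinMode a m) (continuous_cosMode a m)
      (memLp_planeCoord g i) (contDiff_coord hΦ j) (hasCompactSupport_coord hc j)
      fun q _ => by simp [sinMode_zero, sinMode_self m ha]
  rw [e1, e2]
  linear_combination h.sepPairing (a := a) hs (contDiff_coord hΦ 0) (hasCompactSupport_coord hc 0)
    - hx 1 2 - hx 0 1

/-- The first component of the curl drops out since `g` is curl free. In the other two, `w`
contributes its gradient `v` and the second longitudinal derivative of the sine contributes `k² g`.
-/
lemma pairing_trappedCurlLp_curl (ha : 0 < a) {g v : PlaneL2 U}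
    {w : Lp ℂ 2 (volume.restrict (U : Set Plane))} (hcurl : IsPlaneCurlFree g)
    (hv : IsWeakGradient w v) {Φ : Space → Space} (hΦ : ContDiff ℝ ∞ Φ)
    (hc : HasCompactSupport Φ) (hsupp : tsupport Φ ⊆ (productGuide a U : Set Space)) :
    pairing (productGuide a U) (trappedCurlLp a m w g) (curl Φ) =
      pairing (productGuide a U)
        (trappedLp a m U (v + ((waveNumber a m ^ 2 : ℝ) : ℂ) • g)) Φ := by
  have hs := continuous_sinMode a m
  have hco := continuous_cosMode a m
  have hd := fun i j => continuous_partialDeriv (contDiff_coord hΦ i) j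
  have hdc := fun i j => hasCompactSupport_partialDeriv (hasCompactSupport_coord hc i) j
  have hsub : ∀ i, tsupport (fun p => Φ p i) ⊆ (productGuide a U : Set Space) := fun i =>
    (tsupport_comp_subset (g := fun v : Space => v i) (by simp) Φ).trans hsupp
  rw [pairing_trappedCurlLp w g (isTestField_curl hΦ hc), map_add, map_smul,
    pairing_add _ _ (isTestField_of_smooth hΦ hc), pairing_smul,
    pairing_trappedLp g (isTestField_of_smooth hΦ hc),
    pairing_trappedLp v (isTestField_of_smooth hΦ hc)]
  have e0 : sepPairing a U (sinMode a m) w (fun p => curl Φ p 0) = _ :=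
    sepPairing_sub hs (Lp.memLp w) (hd 2 1) (hdc 2 1) (hd 1 2) (hdc 1 2)
  have e1 : sepPairing a U (cosMode a m) (fun q => g q 0) (fun p => curl Φ p 1) = _ :=
    sepPairing_sub hco (memLp_planeCoord g 0) (hd 0 2) (hdc 0 2) (hd 2 0) (hdc 2 0)
  have e2 : sepPairing a U (cosMode a m) (fun q => g q 1) (fun p => curl Φ p 2) = _ :=
    sepPairing_sub hco (memLp_planeCoord g 1) (hd 1 0) (hdc 1 0) (hd 0 1) (hdc 0 1)
  have hzero : ∀ j p, p ∉ (productGuide a U : Set Space) → Φ p j = 0 := fun j p hp =>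
    image_eq_zero_of_notMem_tsupport (f := fun p => Φ p j) fun h => hp (hsub j h)
  -- The cosine does not vanish at the end faces; here the end terms disappear because `Φ` is
  -- supported in the open guide.
  have hx : ∀ i j, sepPairing a U (cosMode a m) (fun q => g q i)
      (partialDeriv 0 fun p => Φ p j) = ((waveNumber a m ^ 2 : ℝ) : ℂ) *
        sepPairing a U (sinMode a m) (fun q => g q i) (fun p => Φ p j) := by
    intro i j
    rw [sepPairing_partialDeriv_zero ha (hasDerivAt_cosMode a m) (continuous_const.mul hs)
      (memLp_planeCoord g i) (contDiff_coord hΦ j) (hasCompactSupport_coord hc j),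
      sepPairing_const_mul]
    · push_cast
      ring
    · intro q _
      rw [hzero j (joinPoint 0 q) fun h => lt_irrefl _ h.1.1,
        hzero j (joinPoint a q) fun h => lt_irrefl _ h.1.2]
      simp
  rw [e0, e1, e2]
  have hw := fun i j => hv.sepPairing (a := a) hs (contDiff_coord hΦ i)
    (hasCompactSupport_coord hc i) (hsub i) j
  have hw0 := hw 2 0
  have hw1 := hw 1 1
  simp only [Fin.succ_zero_eq_one, Fin.succ_one_eq_two] at hw0 hw1
  linear_combination hw0 - hw1 - hcurl.sepPairing (a := a) hco (contDiff_coord hΦ 0)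
    (hasCompactSupport_coord hc 0) (hsub 0) + hx 1 1 - hx 0 2

/-- The action of the curl-curl operator on trapped fields. -/
lemma isCurlCurl_trappedLp (ha : 0 < a) {g v : PlaneL2 U}
    {w : Lp ℂ 2 (volume.restrict (U : Set Plane))} (hdiv : HasNeumannDivergence g w)
    (hcurl : IsPlaneCurlFree g) (hv : IsWeakGradient w v) :
    IsCurlCurl (trappedLp a m U g)
      (trappedLp a m U (v + ((waveNumber a m ^ 2 : ℝ) : ℂ) • g)) :=
  ⟨trappedCurlLp a m w g, fun _ h1 h2 _ => pairing_trappedLp_curl ha hdiv h1 h2,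
    fun _ h1 h2 => sub_eq_zero.2 (pairing_trappedLp_curl ha hdiv h1 h2),
    fun _ h1 h2 h3 => pairing_trappedCurlLp_curl ha hcurl hv h1 h2 h3⟩

end Trapped

/-! ### Neumann eigenfunctions -/

section Neumann

variable {U : TopologicalSpace.Opens Plane}

lemma IsWeakGradient.smul {φ : Lp ℂ 2 (volume.restrict (U : Set Plane))} {g : PlaneL2 U}
    (h : IsWeakGradient φ g) (c : ℂ) : IsWeakGradient (c • φ) (c • g) := by
  intro ψ h1 h2 h3 i
  have e1 : ∫ p in (U : Set Plane), (c • φ) p * (partialDeriv i ψ p : ℂ) =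
      c * ∫ p in (U : Set Plane), φ p * (partialDeriv i ψ p : ℂ) := by
    rw [← integral_const_mul]
    refine integral_congr_ae ?_
    filter_upwards [Lp.coeFn_smul c φ] with p hp
    simp [hp, mul_assoc]
  have e2 : ∫ p in (U : Set Plane), (c • g) p i * (ψ p : ℂ) =
      c * ∫ p in (U : Set Plane), g p i * (ψ p : ℂ) := by
    rw [← integral_const_mul]
    refine integral_congr_ae ?_
    filter_upwards [Lp.coeFn_smul c g] with p hp
    simp [hp, mul_assoc]
  rw [e1, e2, h ψ h1 h2 h3 i]
  ring

lemma integral_mul_partialDeriv {n : ℕ} {ψ χ : EuclideanSpace ℝ (Fin n) → ℝ}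
    (hψ : ContDiff ℝ ∞ ψ) (hχ : ContDiff ℝ ∞ χ) (hχc : HasCompactSupport χ) (i : Fin n) :
    ∫ p, ψ p * partialDeriv i χ p = -∫ p, partialDeriv i ψ p * χ p := by
  have hd := continuous_partialDeriv hχ i
  have hdc := hasCompactSupport_partialDeriv hχc i
  exact integral_mul_fderiv_eq_neg_fderiv_mul_of_integrable
    (((continuous_partialDeriv hψ i).mul hχ.continuous).integrable_of_hasCompactSupport
      hχc.mul_left)
    ((hψ.continuous.mul hd).integrable_of_hasCompactSupport hdc.mul_left)
    ((hψ.continuous.mul hχ.continuous).integrable_of_hasCompactSupport hχc.mul_left)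
    (fun p _ => hψ.differentiable (by simp) p) (fun p _ => hχ.differentiable (by simp) p)

lemma ofReal_integral_eq_setIntegral {n : ℕ} {f : EuclideanSpace ℝ (Fin n) → ℝ}
    {s : Set (EuclideanSpace ℝ (Fin n))} (h : ∀ p ∉ s, f p = 0) :
    ((∫ p, f p : ℝ) : ℂ) = ∫ p in s, (f p : ℂ) := by
  rw [← setIntegral_eq_integral_of_forall_compl_eq_zero (s := s) h, integral_complex_ofReal]

/-- The complex gradient of a real function of two variables. -/
def planeGrad (ψ : Plane → ℝ) (p : Plane) : EuclideanSpace ℂ (Fin 2) :=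
  WithLp.toLp 2 fun i => (partialDeriv i ψ p : ℂ)

lemma memLp_ofReal {n : ℕ} {f : EuclideanSpace ℝ (Fin n) → ℝ} (hf : Continuous f)
    (hc : HasCompactSupport f) (s : Set (EuclideanSpace ℝ (Fin n))) :
    MemLp (fun p => (f p : ℂ)) 2 (volume.restrict s) :=
  (Complex.continuous_ofReal.comp hf).memLp_of_hasCompactSupport
    (hc.comp_left (g := fun r : ℝ => (r : ℂ)) (by simp))

lemma memLp_planeGrad {ψ : Plane → ℝ} (hψ : ContDiff ℝ ∞ ψ) (hc : HasCompactSupport ψ) :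
    MemLp (planeGrad ψ) 2 (volume.restrict (U : Set Plane)) :=
  MemLp.of_eval_piLp fun i =>
    memLp_ofReal (continuous_partialDeriv hψ i) (hasCompactSupport_partialDeriv hc i) _

/-- The test function `χ` vanishes outside `U`, so the integrals extend to the whole plane and no
boundary term arises, although `ψ` may be non-zero on `∂U`. This makes restrictions of smooth
functions admissible in the Neumann variational form. -/
lemma isWeakGradient_planeGrad {ψ : Plane → ℝ} (hψ : ContDiff ℝ ∞ ψ) (hc : HasCompactSupport ψ) :
    IsWeakGradient (U := U) ((memLp_ofReal hψ.continuous hc _).toLp _)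
      ((memLp_planeGrad hψ hc).toLp _) := by
  intro χ h1 h2 h3 i
  have e1 : ∫ p in (U : Set Plane), ((memLp_ofReal hψ.continuous hc (U : Set Plane)).toLp _) p *
      (partialDeriv i χ p : ℂ) = ((∫ p, ψ p * partialDeriv i χ p : ℝ) : ℂ) := by
    rw [ofReal_integral_eq_setIntegral (s := (U : Set Plane))]
    · refine integral_congr_ae ?_
      filter_upwards [(memLp_ofReal hψ.continuous hc (U : Set Plane)).coeFn_toLp] with p hp
      simp [hp]
    · intro p hp
      rw [image_eq_zero_of_notMem_tsupport (f := partialDeriv i χ)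
        fun h => hp (h3 (tsupport_partialDeriv_subset χ i h))]
      simp
  have e2 : ∫ p in (U : Set Plane), ((memLp_planeGrad (U := U) hψ hc).toLp _) p i * (χ p : ℂ) =
      ((∫ p, partialDeriv i ψ p * χ p : ℝ) : ℂ) := by
    rw [ofReal_integral_eq_setIntegral (s := (U : Set Plane))]
    · refine integral_congr_ae ?_
      filter_upwards [(memLp_planeGrad (U := U) hψ hc).coeFn_toLp] with p hp
      simp [hp, planeGrad]
    · intro p hp
      rw [image_eq_zero_of_notMem_tsupport (f := χ) fun h => hp (h3 h)]
      simp
  rw [e1, e2, integral_mul_partialDeriv hψ h1 h2]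
  simp

/-- The variational equation is tested with restrictions of smooth functions; these are real, so the
conjugation in the inner products disappears. -/
lemma IsNeumannEigenfunction.hasNeumannDivergence {lam : ℝ}
    {φ : Lp ℂ 2 (volume.restrict (U : Set Plane))} {g : PlaneL2 U}
    (h : IsNeumannEigenfunction lam φ g) : HasNeumannDivergence g ((lam : ℂ) • φ) := by
  intro ψ h1 h2
  have e := h.2.2 _ _ (isWeakGradient_planeGrad h1 h2)
  rw [L2.inner_def, L2.inner_def, ← integral_const_mul] at e
  have hm := fun i => memLp_ofReal (continuous_partialDeriv h1 i)
    (hasCompactSupport_partialDeriv h2 i) (U : Set Plane)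
  have hi : ∀ i, Integrable (fun p => g p i * (partialDeriv i ψ p : ℂ))
      (volume.restrict (U : Set Plane)) := fun i => (memLp_planeCoord g i).integrable_mul (hm i)
  rw [← integral_add (hi 0) (hi 1)]
  refine Eq.trans ?_ (e.trans ?_)
  · refine integral_congr_ae ?_
    filter_upwards [(memLp_planeGrad (U := U) h1 h2).coeFn_toLp] with p hp
    rw [hp]
    simp [planeGrad, PiLp.inner_apply]
  · refine integral_congr_ae ?_
    filter_upwards [(memLp_ofReal h1.continuous h2 (U : Set Plane)).coeFn_toLp,
      Lp.coeFn_smul (lam : ℂ) φ] with p hp hp'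
    rw [hp, hp']
    simp [mul_assoc]

/-- Testing the equation with `φ` itself would give `lam ‖φ‖² = 0`. -/
lemma IsNeumannEigenfunction.gradient_ne_zero {lam : ℝ} (hlam : 0 < lam)
    {φ : Lp ℂ 2 (volume.restrict (U : Set Plane))} {g : PlaneL2 U}
    (h : IsNeumannEigenfunction lam φ g) : g ≠ 0 := by
  rintro rfl
  have e := h.2.2 φ 0 h.2.1
  rw [inner_zero_left, eq_comm, mul_eq_zero, inner_self_eq_zero] at e
  exact e.elim (fun h0 => hlam.ne' (by exact_mod_cast h0)) h.1

end Neumann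

/-! ### Trapped fields in the domain of the Maxwell operator -/

section Domain

variable {a lam : ℝ} {m : ℕ} {U : TopologicalSpace.Opens Plane}

/-- The trapped field as an element of the domain of the Maxwell operator. -/
def trappedDomain (ha : 0 < a) (m : ℕ) {g v : PlaneL2 U}
    {w : Lp ℂ 2 (volume.restrict (U : Set Plane))} (hdiv : HasNeumannDivergence g w)
    (hcurl : IsPlaneCurlFree g) (hv : IsWeakGradient w v) :
    (maxwellOperator (productGuide a U)).domain :=
  ⟨⟨trappedLp a m U g, isDivFree_trappedLp hcurl⟩, _, isCurlCurl_trappedLp ha hdiv hcurl hv⟩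

lemma lam_add_waveNumber_sq (a lam : ℝ) (m : ℕ) :
    lam + (m : ℝ) ^ 2 * Real.pi ^ 2 / a ^ 2 = lam + waveNumber a m ^ 2 := by
  rw [waveNumber, div_pow, mul_pow]

lemma IsNeumannEigenfunction.exists_isEigenvector (hlam : 0 < lam) (ha : 0 < a) (hm : 1 ≤ m)
    {φ : Lp ℂ 2 (volume.restrict (U : Set Plane))} {g : PlaneL2 U}
    (h : IsNeumannEigenfunction lam φ g) :
    ∃ E : (maxwellOperator (productGuide a U)).domain,
      (((E : HDiv0 (productGuide a U)) : VecL2 (productGuide a U)) :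
        Space → EuclideanSpace ℂ (Fin 3))
          =ᵐ[volume.restrict (productGuide a U : Set Space)] trappedField a m g ∧
      IsEigenvector (maxwellOperator (productGuide a U))
        ((lam + waveNumber a m ^ 2 : ℝ) : ℂ) E := by
  have hdiv := h.hasNeumannDivergence
  have hcurl := h.2.1.isPlaneCurlFree
  have hv := h.2.1.smul (lam : ℂ)
  refine ⟨trappedDomain ha m hdiv hcurl hv, coeFn_trappedLp a m g, fun h0 => ?_, ?_⟩
  · have h1 : trappedLp a m U g = 0 := congrArg
      (fun E : (maxwellOperator (productGuide a U)).domain =>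
        ((E : HDiv0 (productGuide a U)) : VecL2 (productGuide a U))) h0
    have h2 := norm_sq_trappedLp a m g
    rw [h1, norm_zero, zero_pow two_ne_zero, eq_comm, mul_eq_zero] at h2
    -- A zero lift has zero norm, so either the mass of the sine or the norm of `g` vanishes.
    refine h2.elim (sinModeMass_pos ha hm).ne' fun h3 => ?_
    exact h.gradient_ne_zero hlam (norm_eq_zero.1 (pow_eq_zero_iff two_ne_zero |>.1 h3))
  · refine (maxwellOperator_apply_eq_iff (trappedDomain ha m hdiv hcurl hv) _).2 ?_
    have h1 := isCurlCurl_trappedLp (m := m) ha hdiv hcurl hv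
    rw [← add_smul, ← Complex.ofReal_add, LinearMap.map_smul] at h1
    exact h1

/-- Both the field and its image under the operator are values of the same isometry, so norms and
inner products can be computed in the plane. The factor `c` leaves room for normalizing `g`. -/
lemma exists_domain_trappedIsometry (ha : 0 < a) (hm : 1 ≤ m) (c : ℂ) {g v : PlaneL2 U}
    {w : Lp ℂ 2 (volume.restrict (U : Set Plane))} (hdiv : HasNeumannDivergence g w)
    (hcurl : IsPlaneCurlFree g) (hv : IsWeakGradient w v) :
    ∃ u : (maxwellOperator (productGuide a U)).domain,
      ((u : HDiv0 (productGuide a U)) : VecL2 (productGuide a U)) =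
        trappedIsometry ha hm U (c • g) ∧
      ((maxwellOperator (productGuide a U) u : HDiv0 (productGuide a U)) :
        VecL2 (productGuide a U)) =
          trappedIsometry ha hm U (c • (v + ((waveNumber a m ^ 2 : ℝ) : ℂ) • g)) := by
  have h1 := (isCurlCurl_trappedLp (m := m) ha hdiv hcurl hv).smul
    ((((Real.sqrt (sinModeMass a m))⁻¹ : ℝ) : ℂ) * c)
  have hS : ∀ f, ((((Real.sqrt (sinModeMass a m))⁻¹ : ℝ) : ℂ) * c) • trappedLp a m U f =
      trappedIsometry ha hm U (c • f) := by
    intro f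
    rw [mul_smul, ← LinearMap.map_smul]
    rfl
  have h2 := (HDiv0 (productGuide a U)).smul_mem ((((Real.sqrt (sinModeMass a m))⁻¹ : ℝ) : ℂ) * c)
    (isDivFree_trappedLp (a := a) (m := m) hcurl)
  rw [hS] at h2
  rw [hS, hS] at h1
  refine ⟨⟨⟨_, h2⟩, _, h1⟩, rfl, ?_⟩
  exact congrArg Subtype.val ((maxwellOperator_apply_eq_iff
    (⟨⟨_, h2⟩, _, h1⟩ : (maxwellOperator (productGuide a U)).domain) ⟨_, h1.isDivFree⟩).2 h1)

/-- The shift by `s = k²` cancels: the Maxwell residual at `r + s` is the lift of the plane residual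
at `r`. -/
lemma smul_sub_smul_eq {V : Type*} [AddCommGroup V] [Module ℂ V] (c : ℂ) (r s : ℝ) (x y : V) :
    c • (x - (r : ℂ) • y) =
      c • (x + (s : ℂ) • y) - ((r + s : ℝ) : ℂ) • (c • y) := by
  push_cast
  module

lemma norm_inv_norm_smul {V : Type*} [NormedAddCommGroup V] [NormedSpace ℂ V] (x y : V) :
    ‖((‖y‖⁻¹ : ℝ) : ℂ) • x‖ = ‖x‖ / ‖y‖ := by
  rw [norm_smul, Complex.norm_real, norm_inv, norm_norm, div_eq_inv_mul]

/-- Approximate solutions of `-∇ div g = lam g` that are curl free and tangential to the boundary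
yield Weyl sequences of the Maxwell operator. -/
lemma mem_essentialSpectrum_of_orthogonal (ha : 0 < a) (hm : 1 ≤ m)
    {g v : ℕ → PlaneL2 U} {w : ℕ → Lp ℂ 2 (volume.restrict (U : Set Plane))}
    (hdiv : ∀ n, HasNeumannDivergence (g n) (w n)) (hcurl : ∀ n, IsPlaneCurlFree (g n))
    (hv : ∀ n, IsWeakGradient (w n) (v n)) (h0 : ∀ n, g n ≠ 0)
    (horth : ∀ n k, n ≠ k → inner ℂ (g n) (g k) = 0)
    (hlim : Tendsto (fun n => ‖v n - (lam : ℂ) • g n‖ / ‖g n‖) atTop (𝓝 0)) :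
    ((lam + waveNumber a m ^ 2 : ℝ) : ℂ) ∈
      essentialSpectrum (maxwellOperator (productGuide a U)) := by
  have hon : Orthonormal ℂ fun n => ((‖g n‖⁻¹ : ℝ) : ℂ) • g n := by
    refine ⟨fun n => ?_, fun n k hnk => ?_⟩
    · rw [norm_smul, Complex.norm_real, norm_inv, norm_norm,
        inv_mul_cancel₀ (norm_ne_zero_iff.2 (h0 n))]
    · change inner ℂ (((‖g n‖⁻¹ : ℝ) : ℂ) • g n) (((‖g k‖⁻¹ : ℝ) : ℂ) • g k) = 0
      rw [inner_smul_left, inner_smul_right, horth n k hnk, mul_zero, mul_zero]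
  choose u hu hAu using fun n =>
    exists_domain_trappedIsometry ha hm ((‖g n‖⁻¹ : ℝ) : ℂ) (hdiv n) (hcurl n) (hv n)
  have honS := hon.comp_linearIsometry (trappedIsometry ha hm U)
  generalize trappedIsometry ha hm U = S at hu hAu honS
  refine ⟨u, fun n => ?_, fun f => ?_, ?_⟩
  · exact (congrArg norm (hu n)).trans (honS.1 n)
  -- Bessel's inequality: the inner products of a fixed vector with an orthonormal sequence are
  -- square summable, hence tend to zero.
  · have hs := (honS.inner_products_summable (f : VecL2 (productGuide a U))).tendsto_atTop_zero
    have hs' := (Real.continuous_sqrt.tendsto 0).comp hs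
    rw [Real.sqrt_zero] at hs'
    have hin : ∀ n, inner ℂ f (u n : HDiv0 (productGuide a U)) =
        inner ℂ (f : VecL2 (productGuide a U)) (S (((‖g n‖⁻¹ : ℝ) : ℂ) • g n)) := by
      intro n
      rw [← hu n]
      rfl
    simp only [hin]
    refine tendsto_zero_iff_norm_tendsto_zero.2 (hs'.congr fun n => ?_)
    rw [Function.comp_apply, Real.sqrt_sq (norm_nonneg _), norm_inner_symm]
    rfl
  · refine tendsto_zero_iff_norm_tendsto_zero.2 (hlim.congr fun n => ?_)
    have hn : ‖maxwellOperator (productGuide a U) (u n) -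
        ((lam + waveNumber a m ^ 2 : ℝ) : ℂ) • (u n : HDiv0 (productGuide a U))‖ =
        ‖S (((‖g n‖⁻¹ : ℝ) : ℂ) • (v n - (lam : ℂ) • g n))‖ := by
      have e1 := congrArg₂ (fun x y : VecL2 (productGuide a U) =>
        x - ((lam + waveNumber a m ^ 2 : ℝ) : ℂ) • y) (hAu n) (hu n)
      have e2 := congrArg (fun z => ‖S z‖) (smul_sub_smul_eq ((‖g n‖⁻¹ : ℝ) : ℂ) lam
        (waveNumber a m ^ 2) (v n) (g n))
      refine Eq.trans ?_ e2.symm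
      refine (congrArg norm e1).trans ?_
      simp only [S.map_sub, S.map_smul]
    exact ((hn.trans (S.norm_map _)).trans (norm_inv_norm_smul _ _)).symm

end Domain

/-! ### Coordinates in a strip -/

section StripCoordinates

/-- The vector `d` rotated by a right angle. -/
def rotated (d : Plane) : Plane := !₂[-d 1, d 0]

/-- The point with coordinates `(t, s)` in the frame with origin `c` and first axis `d`. -/
def stripPoint (c d : Plane) (z : ℝ × ℝ) : Plane := c + z.1 • d + z.2 • rotated d

/-- The coordinate along `d`. -/
def stripT (c d q : Plane) : ℝ := d 0 * (q 0 - c 0) + d 1 * (q 1 - c 1)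

/-- The coordinate across `d`. -/
def stripS (c d q : Plane) : ℝ := -d 1 * (q 0 - c 0) + d 0 * (q 1 - c 1)

variable {c d : Plane} {h : ℝ}

lemma sq_add_sq_eq_one (hd : ‖d‖ = 1) : d 0 * d 0 + d 1 * d 1 = 1 := by
  have e := EuclideanSpace.norm_sq_eq d
  rw [hd, Fin.sum_univ_two] at e
  simp only [Real.norm_eq_abs, sq_abs] at e
  linarith

lemma stripPoint_apply_zero (z : ℝ × ℝ) : stripPoint c d z 0 = c 0 + z.1 * d 0 - z.2 * d 1 := by
  simp [stripPoint, rotated]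
  ring

lemma stripPoint_apply_one (z : ℝ × ℝ) : stripPoint c d z 1 = c 1 + z.1 * d 1 + z.2 * d 0 := by
  simp [stripPoint, rotated]

lemma stripT_stripPoint (hd : ‖d‖ = 1) (z : ℝ × ℝ) : stripT c d (stripPoint c d z) = z.1 := by
  rw [stripT, stripPoint_apply_zero, stripPoint_apply_one]
  linear_combination z.1 * sq_add_sq_eq_one hd

lemma stripS_stripPoint (hd : ‖d‖ = 1) (z : ℝ × ℝ) : stripS c d (stripPoint c d z) = z.2 := by
  rw [stripS, stripPoint_apply_zero, stripPoint_apply_one]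
  linear_combination z.2 * sq_add_sq_eq_one hd

lemma stripPoint_stripT_stripS (hd : ‖d‖ = 1) (q : Plane) :
    stripPoint c d (stripT c d q, stripS c d q) = q := by
  ext i
  fin_cases i
  · refine (stripPoint_apply_zero _).trans ?_
    simp only [stripT, stripS]
    change _ = q 0
    linear_combination (q 0 - c 0) * sq_add_sq_eq_one hd
  · refine (stripPoint_apply_one _).trans ?_
    simp only [stripT, stripS]
    change _ = q 1
    linear_combination (q 1 - c 1) * sq_add_sq_eq_one hd

lemma continuous_stripT (c d : Plane) : Continuous (stripT c d) := by
  unfold stripT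
  fun_prop

lemma continuous_stripS (c d : Plane) : Continuous (stripS c d) := by
  unfold stripS
  fun_prop

lemma continuous_stripPoint (c d : Plane) : Continuous (stripPoint c d) := by
  unfold stripPoint
  fun_prop

lemma mem_semiStrip_iff (hd : ‖d‖ = 1) {q : Plane} :
    q ∈ semiStrip c d h ↔ 0 < stripT c d q ∧ stripS c d q ∈ Set.Ioo 0 h := by
  constructor
  · rintro ⟨t, s, ht, hs, hsh, rfl⟩
    have e1 : stripT c d (c + t • d + s • !₂[-d 1, d 0]) = t := stripT_stripPoint hd (t, s)
    have e2 : stripS c d (c + t • d + s • !₂[-d 1, d 0]) = s := stripS_stripPoint hd (t, s)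
    rw [e1, e2]
    exact ⟨ht, hs, hsh⟩
  · rintro ⟨ht, hs, hsh⟩
    exact ⟨_, _, ht, hs, hsh, (stripPoint_stripT_stripS hd q).symm⟩

lemma isOpen_semiStrip (hd : ‖d‖ = 1) : IsOpen (semiStrip c d h) := by
  have e : semiStrip c d h = stripT c d ⁻¹' Set.Ioi 0 ∩ stripS c d ⁻¹' Set.Ioo 0 h := by
    ext q
    exact mem_semiStrip_iff hd
  rw [e]
  exact (isOpen_Ioi.preimage (continuous_stripT c d)).inter
    (isOpen_Ioo.preimage (continuous_stripS c d))

/-- The linear isometry that sends the first axis to `d`. -/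
def frameIsometry (hd : ‖d‖ = 1) : Plane ≃ₗᵢ[ℝ] Plane :=
  LinearIsometry.toLinearIsometryEquiv
    { toFun := fun q => q 0 • d + q 1 • rotated d
      map_add' := fun q q' => by
        simp only [PiLp.add_apply]
        module
      map_smul' := fun r q => by
        simp only [PiLp.smul_apply, smul_eq_mul, RingHom.id_apply]
        module
      norm_map' := fun q => by
        refine (sq_eq_sq₀ (norm_nonneg _) (norm_nonneg _)).1 ?_
        rw [EuclideanSpace.norm_sq_eq, EuclideanSpace.norm_sq_eq, Fin.sum_univ_two,
          Fin.sum_univ_two]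
        simp [rotated]
        linear_combination (q 0 ^ 2 + q 1 ^ 2) * sq_add_sq_eq_one hd }
    rfl

/-- The coordinates of the frame with origin `c` and first axis `d`. -/
def stripEquiv (c : Plane) (hd : ‖d‖ = 1) : ℝ × ℝ ≃ᵐ Plane :=
  (MeasurableEquiv.finTwoArrow (α := ℝ)).symm.trans
    ((MeasurableEquiv.toLp 2 (Fin 2 → ℝ)).trans
      ((frameIsometry hd).toMeasurableEquiv.trans (MeasurableEquiv.addLeft c)))

lemma stripEquiv_apply (hd : ‖d‖ = 1) (z : ℝ × ℝ) : stripEquiv c hd z = stripPoint c d z := by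
  rw [stripPoint, add_assoc]
  rfl

lemma measurePreserving_stripEquiv (c : Plane) (hd : ‖d‖ = 1) :
    MeasurePreserving (stripEquiv c hd) := by
  refine (volume_preserving_finTwoArrow ℝ).symm.trans ?_
  refine (PiLp.volume_preserving_toLp (Fin 2)).trans ?_
  refine (LinearIsometryEquiv.measurePreserving (frameIsometry hd)).trans ?_
  exact measurePreserving_add_left volume c

end StripCoordinates

/-! ### Outlets -/

/-- Beyond the abscissa `T` of the frame `(c, d)`, the domain `U` contains the strip of height `h`
and does not meet the two lines that bound it. -/
structure IsOutlet (U : Set Plane) (c d : Plane) (h T : ℝ) : Prop where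
  norm_eq_one : ‖d‖ = 1
  height_pos : 0 < h
  mem : ∀ t s, T < t → s ∈ Set.Ioo 0 h → stripPoint c d (t, s) ∈ U
  bottom_notMem : ∀ t, T < t → stripPoint c d (t, 0) ∉ U
  top_notMem : ∀ t, T < t → stripPoint c d (t, h) ∉ U

/-- The component along the unit vector `d` is `⟨d, c⟩ + t`, which is at least `t - ‖c‖`; the
transverse coordinate plays no role. -/
lemma lt_norm_stripPoint {c d : Plane} (hd : ‖d‖ = 1) {R t : ℝ} (ht : R + ‖c‖ < t) (s : ℝ) :
    R < ‖stripPoint c d (t, s)‖ := by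
  have h1 : inner ℝ d (stripPoint c d (t, s)) = inner ℝ d c + t := by
    rw [PiLp.inner_apply, PiLp.inner_apply, Fin.sum_univ_two, Fin.sum_univ_two,
      stripPoint_apply_zero, stripPoint_apply_one]
    simp only [RCLike.inner_apply, conj_trivial]
    linear_combination t * sq_add_sq_eq_one hd
  have h2 := real_inner_le_norm d (stripPoint c d (t, s))
  have h3 := neg_le_of_abs_le (abs_real_inner_le_norm d c)
  rw [hd, one_mul] at h2 h3
  linarith

/-- A wall point of the chosen strip that lay in `U`, far out, would belong to another strip. That
strip is open, so it would also contain points of the chosen one, against disjointness. -/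
lemma HasStripOutlets.exists_isOutlet {U : Set Plane} (hU : HasStripOutlets U) :
    ∃ c d h T, IsOutlet U c d h T := by
  obtain ⟨M, c, d, h, R, hM, hd, hh, heq, hdisj⟩ := hU
  set i : Fin M := ⟨0, hM⟩
  -- The maximum with `0` covers a negative `R`: the threshold must be non-negative for `t` to be
  -- positive, as membership in the semi-infinite strip requires.
  have hnorm : ∀ t s, max R 0 + ‖c i‖ < t →
      stripPoint (c i) (d i) (t, s) ∉ Metric.ball (0 : Plane) R := by
    intro t s ht hmem
    have h1 := lt_norm_stripPoint (hd i) ht s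
    rw [mem_ball_zero_iff] at hmem
    exact absurd (hmem.trans_le (le_max_left R 0)) (not_lt.2 h1.le)
  have hstrip : ∀ t s, max R 0 + ‖c i‖ < t → s ∈ Set.Ioo 0 (h i) →
      stripPoint (c i) (d i) (t, s) ∈ semiStrip (c i) (d i) (h i) := by
    intro t s ht hs
    rw [mem_semiStrip_iff (hd i), stripT_stripPoint (hd i), stripS_stripPoint (hd i)]
    exact ⟨lt_of_le_of_lt (add_nonneg (le_max_right R 0) (norm_nonneg (c i))) ht, hs⟩
  have hout : ∀ t s, max R 0 + ‖c i‖ < t → s ∈ Set.Icc 0 (h i) → s ∉ Set.Ioo 0 (h i) →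
      stripPoint (c i) (d i) (t, s) ∉ U := by
    intro t s ht hs hs' hmem
    have h1 : stripPoint (c i) (d i) (t, s) ∈ U \ Metric.ball 0 R := ⟨hmem, hnorm t s ht⟩
    rw [heq] at h1
    obtain ⟨j, hj⟩ := Set.mem_iUnion.1 h1.1
    by_cases hij : i = j
    · rw [← hij, mem_semiStrip_iff (hd i), stripS_stripPoint (hd i)] at hj
      exact hs' hj.2
    · have hO : IsOpen {s' : ℝ | stripPoint (c i) (d i) (t, s') ∈
          semiStrip (c j) (d j) (h j)} := by
        refine (isOpen_semiStrip (hd j)).preimage ?_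
        exact (continuous_stripPoint _ _).comp (continuous_const.prodMk continuous_id)
      -- The wall coordinate is a limit of interior ones, so the open trace of strip `j` on this
      -- transverse line meets the interior of strip `i`.
      rw [← closure_Ioo (hh i).ne] at hs
      obtain ⟨s', hs1, hs2⟩ := mem_closure_iff.1 hs _ hO hj
      exact Set.disjoint_left.1 (hdisj i j hij) ⟨hstrip t s' ht hs2, hnorm t s' ht⟩
        ⟨hs1, hnorm t s' ht⟩
  refine ⟨c i, d i, h i, max R 0 + ‖c i‖, hd i, hh i, fun t s ht hs => ?_, fun t ht => ?_,
    fun t ht => ?_⟩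
  · have h1 : stripPoint (c i) (d i) (t, s) ∈ U \ Metric.ball 0 R := by
      rw [heq]
      exact ⟨Set.mem_iUnion.2 ⟨i, hstrip t s ht hs⟩, hnorm t s ht⟩
    exact h1.1
  · exact hout t 0 ht ⟨le_rfl, (hh i).le⟩ fun h0 => lt_irrefl _ h0.1
  · exact hout t (h i) ht ⟨(hh i).le, le_rfl⟩ fun h0 => lt_irrefl _ h0.2

/-! ### Fields supported in an outlet -/

/-- Smooth compactly supported profiles beyond the abscissa `T`. -/
structure IsProfile (T : ℝ) (ρ : ℝ → ℂ) : Prop where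
  contDiff : ContDiff ℝ ∞ ρ
  hasCompactSupport : HasCompactSupport ρ
  tsupport_subset : tsupport ρ ⊆ Set.Ioi T

section Profiles

variable {T : ℝ} {ρ : ℝ → ℂ}

lemma IsProfile.deriv (hρ : IsProfile T ρ) : IsProfile T (deriv ρ) where
  contDiff := hρ.contDiff.deriv'
  hasCompactSupport := hρ.hasCompactSupport.deriv
  tsupport_subset := (closure_minimal support_deriv_subset (isClosed_tsupport ρ)).trans
    hρ.tsupport_subset

lemma IsProfile.neg (hρ : IsProfile T ρ) : IsProfile T (-ρ) where
  contDiff := hρ.contDiff.neg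
  hasCompactSupport := hρ.hasCompactSupport.neg
  tsupport_subset := by
    rw [tsupport, Function.support_neg]
    exact hρ.tsupport_subset

lemma IsProfile.eq_zero (hρ : IsProfile T ρ) {t : ℝ} (ht : t ≤ T) : ρ t = 0 :=
  image_eq_zero_of_notMem_tsupport fun h => not_lt.2 ht (hρ.tsupport_subset h)

lemma IsProfile.hasDerivAt (hρ : IsProfile T ρ) (t : ℝ) :
    HasDerivAt ρ (_root_.deriv ρ t) t :=
  (hρ.contDiff.differentiable (by simp) t).hasDerivAt

lemma IsProfile.integrable_norm_sq (hρ : IsProfile T ρ) : Integrable fun t => ‖ρ t‖ ^ 2 := by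
  have hc : Continuous fun t => ‖ρ t‖ ^ 2 := hρ.contDiff.continuous.norm.pow 2
  refine hc.integrable_of_hasCompactSupport ?_
  exact hρ.hasCompactSupport.comp_left (g := fun x : ℂ => ‖x‖ ^ 2) (by simp)

end Profiles

/-- The function of the strip of height `h` that depends on the first coordinate only, extended by
zero. -/
def stripFun (c d : Plane) (h : ℝ) (ρ : ℝ → ℂ) : Plane → ℂ :=
  (stripS c d ⁻¹' Set.Ioo 0 h).indicator fun q => ρ (stripT c d q)

/-- The longitudinal field with profile `ρ`. -/
def stripField (c d : Plane) (h : ℝ) (ρ : ℝ → ℂ) (q : Plane) : EuclideanSpace ℂ (Fin 2) :=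
  WithLp.toLp 2 fun i => stripFun c d h ρ q * (d i : ℂ)

section Outlet

variable {U : TopologicalSpace.Opens Plane} {c d : Plane} {h T : ℝ} {ρ : ℝ → ℂ}

lemma stripFun_stripPoint (hd : ‖d‖ = 1) (ρ : ℝ → ℂ) (z : ℝ × ℝ) :
    stripFun c d h ρ (stripPoint c d z) = (Set.Ioo 0 h).indicator (fun _ => ρ z.1) z.2 := by
  simp only [stripFun, Set.indicator, Set.mem_preimage, stripS_stripPoint hd, stripT_stripPoint hd]

/-- `stripFun` lives on a doubly infinite strip, but the profile vanishes up to `T` and beyond `T`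
the strip lies in `U`. Integrals over `U` are therefore integrals over the whole strip. -/
lemma IsOutlet.stripFun_eq_zero (ho : IsOutlet (U : Set Plane) c d h T) (hρ : IsProfile T ρ)
    {q : Plane} (hq : q ∉ (U : Set Plane)) : stripFun c d h ρ q = 0 := by
  rw [stripFun, Set.indicator_apply_eq_zero]
  intro hs
  refine hρ.eq_zero (not_lt.1 fun ht => hq ?_)
  rw [← stripPoint_stripT_stripS (c := c) ho.norm_eq_one q]
  exact ho.mem _ _ ht hs

lemma integral_comp_stripPoint {G : Type*} [NormedAddCommGroup G] [NormedSpace ℝ G]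
    (hd : ‖d‖ = 1) (f : Plane → G) : ∫ q, f q = ∫ z, f (stripPoint c d z) := by
  rw [← (measurePreserving_stripEquiv c hd).integral_comp']
  simp only [stripEquiv_apply]

lemma integrable_norm_sq_stripFun (hd : ‖d‖ = 1) (c : Plane) (h : ℝ) (hρ : IsProfile T ρ) :
    Integrable fun q => ‖stripFun c d h ρ q‖ ^ 2 := by
  rw [← (measurePreserving_stripEquiv c hd).integrable_comp_emb
    (stripEquiv c hd).measurableEmbedding]
  have h1 : Integrable fun t => ‖ρ t‖ ^ 2 := hρ.integrable_norm_sq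
  have h2 : Integrable ((Set.Ioo 0 h).indicator fun _ : ℝ => (1 : ℝ)) :=
    (integrable_indicator_iff measurableSet_Ioo).2 (integrableOn_const (by simp))
  refine (h1.mul_prod h2).congr (Eventually.of_forall fun z => ?_)
  simp only [Function.comp_apply, stripEquiv_apply, stripFun_stripPoint hd]
  by_cases hz : z.2 ∈ Set.Ioo 0 h <;> simp [hz]

lemma integral_norm_sq_stripFun (hd : ‖d‖ = 1) (hh : 0 < h) (c : Plane) (ρ : ℝ → ℂ) :
    ∫ q, ‖stripFun c d h ρ q‖ ^ 2 = h * ∫ t, ‖ρ t‖ ^ 2 := by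
  rw [integral_comp_stripPoint (c := c) hd]
  have e : ∀ z : ℝ × ℝ, ‖stripFun c d h ρ (stripPoint c d z)‖ ^ 2 =
      ‖ρ z.1‖ ^ 2 * (Set.Ioo 0 h).indicator (fun _ : ℝ => (1 : ℝ)) z.2 := by
    intro z
    rw [stripFun_stripPoint hd]
    by_cases hz : z.2 ∈ Set.Ioo 0 h <;> simp [hz]
  simp only [e]
  rw [Measure.volume_eq_prod, integral_prod_mul (fun t => ‖ρ t‖ ^ 2), integral_indicator
    measurableSet_Ioo]
  simp [hh.le, mul_comm]

lemma memLp_stripFun (hd : ‖d‖ = 1) (c : Plane) (h : ℝ) (hρ : IsProfile T ρ) (s : Set Plane) :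
    MemLp (stripFun c d h ρ) 2 (volume.restrict s) := by
  have hm : AEStronglyMeasurable (stripFun c d h ρ) (volume.restrict s) :=
    (((hρ.contDiff.continuous.comp (continuous_stripT c d)).stronglyMeasurable).indicator
      (measurableSet_Ioo.preimage (continuous_stripS c d).measurable)).aestronglyMeasurable
  rw [memLp_two_iff_integrable_sq_norm hm]
  exact (integrable_norm_sq_stripFun hd c h hρ).restrict

lemma memLp_stripField (hd : ‖d‖ = 1) (c : Plane) (h : ℝ) (hρ : IsProfile T ρ) (s : Set Plane) :
    MemLp (stripField c d h ρ) 2 (volume.restrict s) :=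
  MemLp.of_eval_piLp fun i => (memLp_stripFun hd c h hρ s).mul_const (d i : ℂ)

lemma norm_stripField (hd : ‖d‖ = 1) (ρ : ℝ → ℂ) (q : Plane) :
    ‖stripField c d h ρ q‖ = ‖stripFun c d h ρ q‖ := by
  refine (sq_eq_sq₀ (norm_nonneg _) (norm_nonneg _)).1 ?_
  rw [EuclideanSpace.norm_sq_eq, Fin.sum_univ_two]
  simp only [stripField, norm_mul, mul_pow, Complex.norm_real, Real.norm_eq_abs, sq_abs]
  linear_combination ‖stripFun c d h ρ q‖ ^ 2 * sq_add_sq_eq_one hd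

lemma IsOutlet.setIntegral_stripFun_mul (ho : IsOutlet (U : Set Plane) c d h T)
    (hρ : IsProfile T ρ) (ψ : Plane → ℝ) :
    ∫ q in (U : Set Plane), stripFun c d h ρ q * (ψ q : ℂ) =
      ∫ z, ρ z.1 * (ψ (stripPoint c d z) : ℂ)
        ∂((volume : Measure ℝ).prod (volume.restrict (Set.Ioo 0 h))) := by
  rw [setIntegral_eq_integral_of_forall_compl_eq_zero
    fun q hq => by rw [ho.stripFun_eq_zero hρ hq, zero_mul],
    integral_comp_stripPoint (c := c) ho.norm_eq_one]
  have e : (volume : Measure ℝ).prod (volume.restrict (Set.Ioo 0 h)) =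
      (volume : Measure (ℝ × ℝ)).restrict (Prod.snd ⁻¹' Set.Ioo 0 h) := by
    rw [← Set.univ_prod, Measure.volume_eq_prod, ← Measure.prod_restrict, Measure.restrict_univ]
  rw [e, ← integral_indicator (measurableSet_Ioo.preimage measurable_snd)]
  refine integral_congr_ae (Eventually.of_forall fun z => ?_)
  simp only [stripFun_stripPoint ho.norm_eq_one]
  by_cases hz : z.2 ∈ Set.Ioo 0 h <;> simp [Set.indicator, hz]

/-- No decay of `ψ` is needed: the profile bounds the range of `t` and the height that of `s`. -/
lemma integrable_profile_mul (c d : Plane) (h : ℝ) (hρ : IsProfile T ρ) {ψ : Plane → ℝ}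
    (hψ : Continuous ψ) :
    Integrable (fun z : ℝ × ℝ => ρ z.1 * (ψ (stripPoint c d z) : ℂ))
      ((volume : Measure ℝ).prod (volume.restrict (Set.Ioo 0 h))) := by
  have hc : Continuous fun z : ℝ × ℝ => ρ z.1 * (ψ (stripPoint c d z) : ℂ) :=
    (hρ.contDiff.continuous.comp continuous_fst).mul
      (Complex.continuous_ofReal.comp (hψ.comp (continuous_stripPoint c d)))
  have h1 : IntegrableOn (fun z : ℝ × ℝ => ρ z.1 * (ψ (stripPoint c d z) : ℂ))
      (tsupport ρ ×ˢ Set.Ioo 0 h) :=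
    (hc.continuousOn.integrableOn_compact
      (hρ.hasCompactSupport.isCompact.prod isCompact_Icc)).mono_set
        (Set.prod_mono le_rfl Set.Ioo_subset_Icc_self)
  have e : (volume : Measure ℝ).prod (volume.restrict (Set.Ioo 0 h)) =
      (volume : Measure (ℝ × ℝ)).restrict (Set.univ ×ˢ Set.Ioo 0 h) := by
    rw [Measure.volume_eq_prod, ← Measure.prod_restrict, Measure.restrict_univ]
  rw [e]
  refine h1.of_forall_sdiff_eq_zero (MeasurableSet.univ.prod measurableSet_Ioo) ?_
  rintro z ⟨⟨-, hz⟩, hz'⟩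
  rw [image_eq_zero_of_notMem_tsupport fun h0 => hz' ⟨h0, hz⟩, zero_mul]

variable {ψ : Plane → ℝ}

lemma hasDerivAt_stripPoint_fst (hψ : ContDiff ℝ ∞ ψ) (t s : ℝ) :
    HasDerivAt (fun t => ψ (stripPoint c d (t, s))) (fderiv ℝ ψ (stripPoint c d (t, s)) d) t := by
  have h1 : HasDerivAt (fun t => stripPoint c d (t, s)) d t := by
    have := (((hasDerivAt_id t).smul_const d).const_add c).add_const (s • rotated d)
    simpa [stripPoint] using this
  exact ((hψ.differentiable (by simp) _).hasFDerivAt).comp_hasDerivAt t h1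

lemma hasDerivAt_stripPoint_snd (hψ : ContDiff ℝ ∞ ψ) (t s : ℝ) :
    HasDerivAt (fun s => ψ (stripPoint c d (t, s)))
      (fderiv ℝ ψ (stripPoint c d (t, s)) (rotated d)) s := by
  have h1 : HasDerivAt (fun s => stripPoint c d (t, s)) (rotated d) s := by
    have := ((hasDerivAt_id s).smul_const (rotated d)).const_add (c + t • d)
    simpa [stripPoint] using this
  exact ((hψ.differentiable (by simp) _).hasFDerivAt).comp_hasDerivAt s h1

lemma continuous_fderiv_apply (hψ : ContDiff ℝ ∞ ψ) (v : Plane) :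
    Continuous fun q => fderiv ℝ ψ q v :=
  (hψ.continuous_fderiv (by simp)).clm_apply continuous_const

/-- Integration by parts along an outlet. -/
lemma IsOutlet.integral_stripFun_mul_fderiv (ho : IsOutlet (U : Set Plane) c d h T)
    (hρ : IsProfile T ρ) (hψ : ContDiff ℝ ∞ ψ) :
    ∫ q in (U : Set Plane), stripFun c d h ρ q * (fderiv ℝ ψ q d : ℂ) =
      -∫ q in (U : Set Plane), stripFun c d h (deriv ρ) q * (ψ q : ℂ) := by
  have hψ' := continuous_fderiv_apply hψ d
  rw [ho.setIntegral_stripFun_mul hρ fun q => fderiv ℝ ψ q d,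
    ho.setIntegral_stripFun_mul hρ.deriv ψ,
    integral_prod_symm _ (integrable_profile_mul c d h hρ hψ'),
    integral_prod_symm _ (integrable_profile_mul c d h hρ.deriv hψ.continuous), ← integral_neg]
  refine integral_congr_ae (Eventually.of_forall fun s => ?_)
  have hp : Continuous fun t : ℝ => stripPoint c d (t, s) :=
    (continuous_stripPoint c d).comp (continuous_id.prodMk continuous_const)
  have hc := Complex.continuous_ofReal.comp (hψ.continuous.comp hp)
  have hc' := Complex.continuous_ofReal.comp (hψ'.comp hp)
  -- The compact support of the profile removes the end terms in `t`. The integration runs parallel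
  -- to the walls, so `ψ` may be arbitrary on them.
  exact integral_mul_deriv_eq_deriv_mul_of_integrable
    (fun t _ => hρ.hasDerivAt t)
    (fun t _ => (hasDerivAt_stripPoint_fst hψ t s).ofReal_comp)
    ((hρ.contDiff.continuous.mul hc').integrable_of_hasCompactSupport
      hρ.hasCompactSupport.mul_right)
    ((hρ.deriv.contDiff.continuous.mul hc).integrable_of_hasCompactSupport
      hρ.deriv.hasCompactSupport.mul_right)
    ((hρ.contDiff.continuous.mul hc).integrable_of_hasCompactSupport
      hρ.hasCompactSupport.mul_right)

/-- Integration by parts across an outlet. -/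
lemma IsOutlet.integral_stripFun_mul_fderiv_rotated (ho : IsOutlet (U : Set Plane) c d h T)
    (hρ : IsProfile T ρ) (hψ : ContDiff ℝ ∞ ψ) (hs : tsupport ψ ⊆ (U : Set Plane)) :
    ∫ q in (U : Set Plane), stripFun c d h ρ q * (fderiv ℝ ψ q (rotated d) : ℂ) = 0 := by
  have hψ' := continuous_fderiv_apply hψ (rotated d)
  rw [ho.setIntegral_stripFun_mul hρ fun q => fderiv ℝ ψ q (rotated d),
    integral_prod _ (integrable_profile_mul c d h hρ hψ')]
  refine (integral_congr_ae (Eventually.of_forall fun t => ?_)).trans (integral_zero ℝ ℂ)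
  simp only
  -- Up to `T` the profile is zero. Beyond it, both ends of the transverse segment lie outside `U`,
  -- where `ψ` vanishes, so the integral of its derivative is zero.
  rcases le_or_gt t T with ht | ht
  · simp [hρ.eq_zero ht]
  · have hp : Continuous fun s : ℝ => stripPoint c d (t, s) :=
      (continuous_stripPoint c d).comp (continuous_const.prodMk continuous_id)
    have hzero : ∀ q, q ∉ (U : Set Plane) → ψ q = 0 := fun q hq =>
      image_eq_zero_of_notMem_tsupport fun h0 => hq (hs h0)
    have e := intervalIntegral.integral_eq_sub_of_hasDerivAt (a := 0) (b := h)
      (fun s _ => hasDerivAt_stripPoint_snd (c := c) (d := d) hψ t s)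
      ((hψ'.comp hp).intervalIntegrable _ _)
    rw [hzero _ (ho.top_notMem t ht), hzero _ (ho.bottom_notMem t ht), sub_zero,
      intervalIntegral.integral_of_le ho.height_pos.le, integral_Ioc_eq_integral_Ioo] at e
    rw [integral_const_mul, integral_complex_ofReal, e]
    simp

lemma fderiv_eq_sum (ψ : Plane → ℝ) (q v : Plane) :
    fderiv ℝ ψ q v = v 0 * partialDeriv 0 ψ q + v 1 * partialDeriv 1 ψ q := by
  have e : v = v 0 • EuclideanSpace.single 0 (1 : ℝ) + v 1 • EuclideanSpace.single 1 (1 : ℝ) := by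
    ext i
    fin_cases i <;> simp
  conv_lhs => rw [e]
  rw [map_add, map_smul, map_smul]
  rfl

/-- The class of `stripFun`. -/
def stripFunLp (U : TopologicalSpace.Opens Plane) (c : Plane) (h : ℝ) (hd : ‖d‖ = 1)
    (hρ : IsProfile T ρ) : Lp ℂ 2 (volume.restrict (U : Set Plane)) :=
  (memLp_stripFun hd c h hρ U).toLp _

/-- The class of `stripField`. -/
def stripFieldLp (U : TopologicalSpace.Opens Plane) (c : Plane) (h : ℝ) (hd : ‖d‖ = 1)
    (hρ : IsProfile T ρ) : PlaneL2 U :=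
  (memLp_stripField hd c h hρ U).toLp _

lemma setIntegral_stripFunLp_mul (hd : ‖d‖ = 1) (hρ : IsProfile T ρ) (χ : Plane → ℝ) :
    ∫ q in (U : Set Plane), stripFunLp U c h hd hρ q * (χ q : ℂ) =
      ∫ q in (U : Set Plane), stripFun c d h ρ q * (χ q : ℂ) := by
  refine integral_congr_ae ?_
  filter_upwards [(memLp_stripFun hd c h hρ (U : Set Plane)).coeFn_toLp] with q hq
  rw [← hq]
  rfl

lemma setIntegral_stripFieldLp_mul (hd : ‖d‖ = 1) (hρ : IsProfile T ρ) (χ : Plane → ℝ)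
    (i : Fin 2) :
    ∫ q in (U : Set Plane), stripFieldLp U c h hd hρ q i * (χ q : ℂ) =
      d i * ∫ q in (U : Set Plane), stripFun c d h ρ q * (χ q : ℂ) := by
  rw [← integral_const_mul]
  refine integral_congr_ae ?_
  filter_upwards [(memLp_stripField hd c h hρ (U : Set Plane)).coeFn_toLp] with q hq
  have e : stripFieldLp U c h hd hρ q i = stripFun c d h ρ q * (d i : ℂ) :=
    congrArg (fun v => v i) hq
  rw [e]
  ring

lemma integrable_stripFun_mul (hd : ‖d‖ = 1) (hρ : IsProfile T ρ) {χ : Plane → ℝ}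
    (hχ : Continuous χ) (hc : HasCompactSupport χ) :
    Integrable (fun q => stripFun c d h ρ q * (χ q : ℂ)) (volume.restrict (U : Set Plane)) :=
  (memLp_stripFun hd c h hρ (U : Set Plane)).integrable_mul (memLp_ofReal hχ hc (U : Set Plane))

lemma IsProfile.setIntegral_stripFun_fderiv (hρ : IsProfile T ρ) (hd : ‖d‖ = 1)
    (hψ : ContDiff ℝ ∞ ψ) (hc : HasCompactSupport ψ) (v : Plane) :
    ∫ q in (U : Set Plane), stripFun c d h ρ q * (fderiv ℝ ψ q v : ℂ) =
      v 0 * (∫ q in (U : Set Plane), stripFun c d h ρ q * (partialDeriv 0 ψ q : ℂ)) +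
        v 1 * ∫ q in (U : Set Plane), stripFun c d h ρ q * (partialDeriv 1 ψ q : ℂ) := by
  have hi := fun i => integrable_stripFun_mul (U := U) (c := c) (h := h) hd hρ
    (continuous_partialDeriv hψ i) (hasCompactSupport_partialDeriv hc i)
  rw [← integral_const_mul, ← integral_const_mul,
    ← integral_add ((hi 0).const_mul _) ((hi 1).const_mul _)]
  refine integral_congr_ae (Eventually.of_forall fun q => ?_)
  simp only [fderiv_eq_sum ψ q v, Complex.ofReal_add, Complex.ofReal_mul]
  ring

/-- Pairing `ρ d` with `∇ψ` leaves `ρ` times the derivative of `ψ` along the outlet, and integration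
by parts in that direction never sees the walls. -/
lemma IsOutlet.hasNeumannDivergence (ho : IsOutlet (U : Set Plane) c d h T)
    (hρ : IsProfile T ρ) :
    HasNeumannDivergence (stripFieldLp U c h ho.norm_eq_one hρ)
      (stripFunLp U c h ho.norm_eq_one hρ.deriv.neg) := by
  intro ψ h1 h2
  rw [setIntegral_stripFieldLp_mul, setIntegral_stripFieldLp_mul, setIntegral_stripFunLp_mul,
    ← hρ.setIntegral_stripFun_fderiv ho.norm_eq_one h1 h2, ho.integral_stripFun_mul_fderiv hρ h1,
    ← integral_neg]
  refine integral_congr_ae (Eventually.of_forall fun q => ?_)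
  simp only [stripFun, Set.indicator]
  split_ifs <;> simp

/-- The combination `d₁ ∂₀ - d₀ ∂₁` is minus the transverse derivative, and `ρ` does not depend on
the transverse coordinate. -/
lemma IsOutlet.isPlaneCurlFree (ho : IsOutlet (U : Set Plane) c d h T) (hρ : IsProfile T ρ) :
    IsPlaneCurlFree (stripFieldLp U c h ho.norm_eq_one hρ) := by
  intro ψ h1 h2 h3
  have e := ho.integral_stripFun_mul_fderiv_rotated hρ h1 h3
  rw [hρ.setIntegral_stripFun_fderiv ho.norm_eq_one h1 h2] at e
  rw [setIntegral_stripFieldLp_mul, setIntegral_stripFieldLp_mul]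
  simp only [rotated, PiLp.toLp_apply, Matrix.cons_val_zero, Matrix.cons_val_one,
    Complex.ofReal_neg] at e
  linear_combination -e

/-- As `d` is a unit vector, `∂₀ = d₀ ∂_d - d₁ ∂_r` and `∂₁ = d₁ ∂_d + d₀ ∂_r` with `r = rotated d`.
The `∂_r` part integrates to zero; the `∂_d` part moves the derivative onto `ρ`. -/
lemma IsOutlet.isWeakGradient (ho : IsOutlet (U : Set Plane) c d h T) (hρ : IsProfile T ρ) :
    IsWeakGradient (stripFunLp U c h ho.norm_eq_one hρ)
      (stripFieldLp U c h ho.norm_eq_one hρ.deriv) := by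
  intro ψ h1 h2 h3 i
  have hd := ho.norm_eq_one
  have e1 := ho.integral_stripFun_mul_fderiv hρ h1
  have e2 := ho.integral_stripFun_mul_fderiv_rotated hρ h1 h3
  rw [hρ.setIntegral_stripFun_fderiv hd h1 h2] at e1 e2
  rw [setIntegral_stripFunLp_mul, setIntegral_stripFieldLp_mul]
  simp only [rotated, PiLp.toLp_apply, Matrix.cons_val_zero, Matrix.cons_val_one,
    Complex.ofReal_neg] at e2
  have e3 : (d 0 : ℂ) * d 0 + d 1 * d 1 = 1 := by
    rw [← Complex.ofReal_mul, ← Complex.ofReal_mul, ← Complex.ofReal_add, sq_add_sq_eq_one hd,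
      Complex.ofReal_one]
  fin_cases i
  · simp only [Fin.zero_eta]
    linear_combination (d 0 : ℂ) * e1 - (d 1 : ℂ) * e2 -
      (∫ q in (U : Set Plane), stripFun c d h ρ q * (partialDeriv 0 ψ q : ℂ)) * e3
  · simp only [Fin.mk_one]
    linear_combination (d 1 : ℂ) * e1 + (d 0 : ℂ) * e2 -
      (∫ q in (U : Set Plane), stripFun c d h ρ q * (partialDeriv 1 ψ q : ℂ)) * e3

end Outlet

/-! ### Wave packets in an outlet -/

section WavePackets

/-- The modulated envelope `exp (i ζ t) χ (ε t)`. -/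
def wavePacket (ζ : ℝ) (χ : ℝ → ℝ) (ε t : ℝ) : ℂ :=
  Complex.exp (Complex.I * ζ * t) * (χ (ε * t) : ℂ)

variable {ζ ε T : ℝ} {χ : ℝ → ℝ}

lemma norm_exp_I_mul (ζ t : ℝ) : ‖Complex.exp (Complex.I * ζ * t)‖ = 1 := by
  rw [mul_assoc, mul_comm, ← Complex.ofReal_mul, Complex.norm_exp_ofReal_mul_I]

lemma norm_wavePacket (ζ : ℝ) (χ : ℝ → ℝ) (ε t : ℝ) : ‖wavePacket ζ χ ε t‖ = |χ (ε * t)| := by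
  rw [wavePacket, norm_mul, norm_exp_I_mul, one_mul, Complex.norm_real, Real.norm_eq_abs]

lemma hasDerivAt_exp_I_mul (ζ t : ℝ) :
    HasDerivAt (fun t : ℝ => Complex.exp (Complex.I * ζ * t))
      (Complex.exp (Complex.I * ζ * t) * (Complex.I * ζ)) t := by
  have h := ((hasDerivAt_id t).ofReal_comp.const_mul (Complex.I * ζ)).cexp
  simpa using h

lemma hasDerivAt_dilation (hχ : ContDiff ℝ ∞ χ) (ε t : ℝ) :
    HasDerivAt (fun t : ℝ => (χ (ε * t) : ℂ)) ((ε * deriv χ (ε * t) : ℝ) : ℂ) t := by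
  have h1 : HasDerivAt χ (deriv χ (ε * t)) (ε * t) :=
    (hχ.differentiable (by simp) _).hasDerivAt
  have h2 : HasDerivAt (fun t => ε * t) ε t := by
    simpa using (hasDerivAt_id t).const_mul ε
  have h3 := (h1.comp t h2).ofReal_comp
  rw [mul_comm] at h3
  exact h3

lemma deriv_wavePacket (hχ : ContDiff ℝ ∞ χ) (ζ ε : ℝ) :
    deriv (wavePacket ζ χ ε) = fun t => Complex.I * ζ * wavePacket ζ χ ε t +
      ε * wavePacket ζ (deriv χ) ε t := by
  funext t
  have h := ((hasDerivAt_exp_I_mul ζ t).mul (hasDerivAt_dilation hχ ε t)).deriv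
  refine Eq.trans h ?_
  simp only [wavePacket, Complex.ofReal_mul]
  ring

lemma contDiff_wavePacket (hχ : ContDiff ℝ ∞ χ) (ζ ε : ℝ) : ContDiff ℝ ∞ (wavePacket ζ χ ε) := by
  refine ContDiff.mul ?_ ?_
  · exact (contDiff_const.mul Complex.ofRealCLM.contDiff).cexp
  · exact Complex.ofRealCLM.contDiff.comp (hχ.comp (contDiff_const.mul contDiff_id))

lemma deriv_deriv_wavePacket (hχ : ContDiff ℝ ∞ χ) (ζ ε t : ℝ) :
    deriv (deriv (wavePacket ζ χ ε)) t = -(ζ ^ 2 : ℂ) * wavePacket ζ χ ε t +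
      (ε : ℂ) * (2 * Complex.I * ζ * wavePacket ζ (deriv χ) ε t +
        ε * wavePacket ζ (deriv (deriv χ)) ε t) := by
  have hχ' : ContDiff ℝ ∞ (deriv χ) := hχ.deriv'
  have hd := fun {χ : ℝ → ℝ} (hχ : ContDiff ℝ ∞ χ) =>
    ((contDiff_wavePacket hχ ζ ε).differentiable (by simp) t).hasDerivAt
  rw [deriv_wavePacket hχ]
  refine (((hd hχ).const_mul _).add ((hd hχ').const_mul _)).deriv.trans ?_
  rw [deriv_wavePacket hχ, deriv_wavePacket hχ']
  linear_combination (ζ ^ 2 * wavePacket ζ χ ε t : ℂ) * Complex.I_sq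

/-- The terms in `ζ²` cancel; in those left, each derivative of the envelope brings a factor `ε`.
One factor is kept, the second is bounded by `1`. -/
lemma norm_deriv_deriv_wavePacket_le (hχ : ContDiff ℝ ∞ χ) (ζ t : ℝ) (h0 : 0 < ε) (h1 : ε ≤ 1) :
    ‖deriv (deriv (wavePacket ζ χ ε)) t + (ζ ^ 2 : ℂ) * wavePacket ζ χ ε t‖ ≤
      ε * (2 * |ζ| * |deriv χ (ε * t)| + |deriv (deriv χ) (ε * t)|) := by
  rw [deriv_deriv_wavePacket hχ]
  have e : -(ζ ^ 2 : ℂ) * wavePacket ζ χ ε t +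
      (ε : ℂ) * (2 * Complex.I * ζ * wavePacket ζ (deriv χ) ε t +
        ε * wavePacket ζ (deriv (deriv χ)) ε t) + (ζ ^ 2 : ℂ) * wavePacket ζ χ ε t =
      (ε : ℂ) * (2 * Complex.I * ζ * wavePacket ζ (deriv χ) ε t +
        ε * wavePacket ζ (deriv (deriv χ)) ε t) := by ring
  rw [e, norm_mul, Complex.norm_real, Real.norm_eq_abs, abs_of_pos h0]
  refine mul_le_mul_of_nonneg_left ((norm_add_le _ _).trans ?_) h0.le
  rw [norm_mul, norm_mul, norm_mul, norm_mul, norm_wavePacket, norm_wavePacket,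
    Complex.norm_I, Complex.norm_real, Complex.norm_real, Complex.norm_ofNat, Real.norm_eq_abs,
    Real.norm_eq_abs, abs_of_pos h0, mul_one]
  have := mul_le_mul_of_nonneg_right h1 (abs_nonneg (deriv (deriv χ) (ε * t)))
  linarith

/-- Dividing by `ε ≤ 1` pushes the support outwards, so it stays beyond `5T/4 > T`. -/
lemma isProfile_wavePacket (hχ : ContDiff ℝ ∞ χ) (hT : 0 < T)
    (hs : ∀ t, χ t ≠ 0 → t ∈ Set.Icc (5 * T / 4) (7 * T / 4)) (ζ : ℝ) (h0 : 0 < ε) (h1 : ε ≤ 1) :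
    IsProfile T (wavePacket ζ χ ε) := by
  have hsub : tsupport (wavePacket ζ χ ε) ⊆ Set.Icc (5 * T / 4 / ε) (7 * T / 4 / ε) := by
    refine closure_minimal (fun t ht => ?_) isClosed_Icc
    have h2 := hs (ε * t) fun h3 => ht (by simp [wavePacket, h3])
    exact ⟨(div_le_iff₀' h0).2 h2.1, (le_div_iff₀' h0).2 h2.2⟩
  refine ⟨contDiff_wavePacket hχ ζ ε,
    isCompact_Icc.of_isClosed_subset (isClosed_tsupport _) hsub, hsub.trans fun t ht => ?_⟩
  have h2 : 5 * T / 4 ≤ 5 * T / 4 / ε := le_div_self (by positivity) h0 h1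
  have h3 : 5 * T / 4 ≤ t := h2.trans ht.1
  rw [Set.mem_Ioi]
  linarith

end WavePackets

/-! ### Norms, residuals and orthogonality of the wave packets; the Weyl sequence -/

section OutletFields

variable {U : TopologicalSpace.Opens Plane} {c d : Plane} {h T : ℝ} {ρ σ : ℝ → ℂ}

lemma IsOutlet.mono {U : Set Plane} {T' : ℝ} (ho : IsOutlet U c d h T) (hT : T ≤ T') :
    IsOutlet U c d h T' :=
  ⟨ho.norm_eq_one, ho.height_pos, fun t s ht hs => ho.mem t s (hT.trans_lt ht) hs,
    fun t ht => ho.bottom_notMem t (hT.trans_lt ht), fun t ht => ho.top_notMem t (hT.trans_lt ht)⟩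

lemma IsProfile.sub_const_mul (hρ : IsProfile T ρ) (hσ : IsProfile T σ) (l : ℂ) :
    IsProfile T fun t => ρ t - l * σ t where
  contDiff := hρ.contDiff.sub (contDiff_const.mul hσ.contDiff)
  hasCompactSupport := hρ.hasCompactSupport.sub hσ.hasCompactSupport.mul_left
  tsupport_subset := by
    refine (closure_minimal (fun t ht => ?_) ((isClosed_tsupport ρ).union
      (isClosed_tsupport σ))).trans (Set.union_subset hρ.tsupport_subset hσ.tsupport_subset)
    by_contra h0
    rw [Set.mem_union, not_or] at h0
    refine ht ?_
    simp only
    rw [image_eq_zero_of_notMem_tsupport h0.1, image_eq_zero_of_notMem_tsupport h0.2, mul_zero,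
      sub_zero]

lemma IsOutlet.norm_sq_stripFieldLp (ho : IsOutlet (U : Set Plane) c d h T)
    (hρ : IsProfile T ρ) :
    ‖stripFieldLp U c h ho.norm_eq_one hρ‖ ^ 2 = h * ∫ t, ‖ρ t‖ ^ 2 := by
  have e : ∫ q in (U : Set Plane), ‖stripFun c d h ρ q‖ ^ 2 = ∫ q, ‖stripFun c d h ρ q‖ ^ 2 :=
    setIntegral_eq_integral_of_forall_compl_eq_zero fun q hq => by
      rw [ho.stripFun_eq_zero hρ hq, norm_zero, zero_pow two_ne_zero]
  rw [norm_sq_lp, ← integral_norm_sq_stripFun ho.norm_eq_one ho.height_pos c ρ, ← e]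
  refine integral_congr_ae ?_
  filter_upwards [(memLp_stripField ho.norm_eq_one c h hρ (U : Set Plane)).coeFn_toLp] with q hq
  rw [← norm_stripField ho.norm_eq_one ρ q, ← hq]
  rfl

lemma stripFieldLp_sub_smul (hd : ‖d‖ = 1) (hρ : IsProfile T ρ) (hσ : IsProfile T σ) (l : ℂ) :
    stripFieldLp U c h hd hρ - l • stripFieldLp U c h hd hσ =
      stripFieldLp U c h hd (hρ.sub_const_mul hσ l) := by
  unfold stripFieldLp
  rw [← MemLp.toLp_const_smul, ← MemLp.toLp_sub, MemLp.toLp_eq_toLp_iff]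
  refine Eventually.of_forall fun q => ?_
  ext i
  simp only [stripField, stripFun, Set.indicator, Pi.sub_apply, Pi.smul_apply, PiLp.sub_apply,
    PiLp.smul_apply, smul_eq_mul]
  split_ifs <;> ring

lemma inner_stripFieldLp_eq_zero (hd : ‖d‖ = 1) (hρ : IsProfile T ρ) (hσ : IsProfile T σ)
    (hdisj : ∀ t, ρ t = 0 ∨ σ t = 0) :
    inner ℂ (stripFieldLp U c h hd hρ) (stripFieldLp U c h hd hσ) = 0 := by
  rw [L2.inner_def]
  refine integral_eq_zero_of_ae ?_
  filter_upwards [(memLp_stripField hd c h hρ (U : Set Plane)).coeFn_toLp,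
    (memLp_stripField hd c h hσ (U : Set Plane)).coeFn_toLp] with q hq hq'
  have e : inner ℂ (stripFieldLp U c h hd hρ q) (stripFieldLp U c h hd hσ q) =
      inner ℂ (stripField c d h ρ q) (stripField c d h σ q) := congrArg₂ (inner ℂ) hq hq'
  refine e.trans ?_
  rcases hdisj (stripT c d q) with h0 | h0 <;>
    simp [PiLp.inner_apply, stripField, stripFun, Set.indicator, h0]

/-- The interval starts beyond `T`, and its end points have ratio `7/5 < 2`, so that dilations by
powers of two separate the supports. -/
lemma exists_envelope (hT : 0 < T) : ∃ χ : ℝ → ℝ, ContDiff ℝ ∞ χ ∧ HasCompactSupport χ ∧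
    (∀ t, χ t ≠ 0 → t ∈ Set.Icc (5 * T / 4) (7 * T / 4)) ∧ 0 < ∫ t, χ t ^ 2 := by
  let b : ContDiffBump (3 * T / 2) := ⟨T / 8, T / 4, by positivity, by linarith⟩
  refine ⟨b, b.contDiff, b.hasCompactSupport, fun t ht => ?_, ?_⟩
  · have h1 : t ∈ Function.support b := ht
    rw [b.support_eq, Metric.mem_ball, Real.dist_eq, abs_lt] at h1
    have h2 : b.rOut = T / 4 := rfl
    rw [h2] at h1
    constructor <;> linarith [h1.1, h1.2]
  · refine (b.continuous.pow 2).integral_pos_of_hasCompactSupport_nonneg_nonzero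
      (b.hasCompactSupport.comp_left (g := fun x : ℝ => x ^ 2) (by simp))
      (fun t => sq_nonneg _) (x := 3 * T / 2) ?_
    rw [b.one_of_mem_closedBall (Metric.mem_closedBall_self b.rIn_pos.le)]
    norm_num

variable {χ : ℝ → ℝ} {ζ ε : ℝ}

lemma IsOutlet.norm_sq_wavePacket (ho : IsOutlet (U : Set Plane) c d h T) (h0 : 0 < ε)
    (hρ : IsProfile T (wavePacket ζ χ ε)) :
    ‖stripFieldLp U c h ho.norm_eq_one hρ‖ ^ 2 = h * (ε⁻¹ * ∫ t, χ t ^ 2) := by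
  rw [ho.norm_sq_stripFieldLp]
  simp only [norm_wavePacket, sq_abs]
  rw [Measure.integral_comp_mul_left (fun t => χ t ^ 2) ε, smul_eq_mul,
    abs_of_pos (inv_pos.2 h0)]

/-- The envelope of the residual of a wave packet. -/
def residualEnvelope (ζ : ℝ) (χ : ℝ → ℝ) (t : ℝ) : ℝ :=
  2 * |ζ| * |deriv χ t| + |deriv (deriv χ) t|

lemma integrable_sq_residualEnvelope (hχ : ContDiff ℝ ∞ χ) (hχc : HasCompactSupport χ) (ζ : ℝ) :
    Integrable fun t => residualEnvelope ζ χ t ^ 2 := by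
  have hχ' : ContDiff ℝ ∞ (deriv χ) := hχ.deriv'
  have hχ'' : ContDiff ℝ ∞ (deriv (deriv χ)) := hχ'.deriv'
  have hβ : Continuous (residualEnvelope ζ χ) :=
    (continuous_const.mul hχ'.continuous.abs).add hχ''.continuous.abs
  have h1 : HasCompactSupport fun t => |deriv χ t| :=
    hχc.deriv.comp_left (g := fun x : ℝ => |x|) abs_zero
  have h2 : HasCompactSupport fun t => |deriv (deriv χ) t| :=
    hχc.deriv.deriv.comp_left (g := fun x : ℝ => |x|) abs_zero
  have hβc : HasCompactSupport (residualEnvelope ζ χ) := HasCompactSupport.add h1.mul_left h2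
  have hc : Continuous fun t => residualEnvelope ζ χ t ^ 2 := hβ.pow 2
  refine hc.integrable_of_hasCompactSupport ?_
  exact hβc.comp_left (g := fun x : ℝ => x ^ 2) (by simp)

/-- The factor `ε²` is the square of the pointwise residual bound, and `ε⁻¹` comes from the change
of variable `t ↦ εt`. -/
lemma IsOutlet.norm_sq_residual_le (ho : IsOutlet (U : Set Plane) c d h T)
    (hχ : ContDiff ℝ ∞ χ) (hχc : HasCompactSupport χ) (h0 : 0 < ε) (h1 : ε ≤ 1)
    (hρ : IsProfile T (wavePacket ζ χ ε)) :
    ‖stripFieldLp U c h ho.norm_eq_one hρ.deriv.neg.deriv -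
        (ζ ^ 2 : ℂ) • stripFieldLp U c h ho.norm_eq_one hρ‖ ^ 2 ≤
      h * (ε ^ 2 * (ε⁻¹ * ∫ t, residualEnvelope ζ χ t ^ 2)) := by
  rw [stripFieldLp_sub_smul, ho.norm_sq_stripFieldLp]
  refine mul_le_mul_of_nonneg_left ?_ ho.height_pos.le
  have hbound : ∀ t, ‖deriv (-deriv (wavePacket ζ χ ε)) t - (ζ ^ 2 : ℂ) * wavePacket ζ χ ε t‖ ^ 2 ≤
      ε ^ 2 * residualEnvelope ζ χ (ε * t) ^ 2 := by
    intro t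
    have h2 := norm_deriv_deriv_wavePacket_le hχ ζ t h0 h1
    -- The field carries `-ρ'' - ζ²ρ`, the pointwise bound is for `ρ'' + ζ²ρ`.
    rw [← norm_neg] at h2
    rw [← mul_pow, deriv.neg]
    refine pow_le_pow_left₀ (norm_nonneg _) (le_trans (le_of_eq ?_) h2) 2
    congr 1
    ring
  refine (integral_mono (hρ.deriv.neg.deriv.sub_const_mul hρ _).integrable_norm_sq
    (((integrable_sq_residualEnvelope hχ hχc ζ).comp_mul_left' h0.ne').const_mul _)
      hbound).trans (le_of_eq ?_)
  rw [integral_const_mul, Measure.integral_comp_mul_left (fun t => residualEnvelope ζ χ t ^ 2) ε,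
    smul_eq_mul, abs_of_pos (inv_pos.2 h0)]

/-- The height and the factor `ε⁻¹` occur in both squared norms and cancel, which leaves a bound
linear in `ε`. -/
lemma IsOutlet.norm_residual_div_le (ho : IsOutlet (U : Set Plane) c d h T)
    (hχ : ContDiff ℝ ∞ χ) (hχc : HasCompactSupport χ) (hA : 0 < ∫ t, χ t ^ 2) (h0 : 0 < ε)
    (h1 : ε ≤ 1) (hρ : IsProfile T (wavePacket ζ χ ε)) :
    ‖stripFieldLp U c h ho.norm_eq_one hρ.deriv.neg.deriv -
        (ζ ^ 2 : ℂ) • stripFieldLp U c h ho.norm_eq_one hρ‖ /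
          ‖stripFieldLp U c h ho.norm_eq_one hρ‖ ≤
      ε * Real.sqrt ((∫ t, residualEnvelope ζ χ t ^ 2) / ∫ t, χ t ^ 2) := by
  have hB : 0 ≤ ∫ t, residualEnvelope ζ χ t ^ 2 := integral_nonneg fun t => sq_nonneg _
  refine div_le_of_le_mul₀ (norm_nonneg _) (mul_nonneg h0.le (Real.sqrt_nonneg _)) ?_
  refine le_of_sq_le_sq ?_ (mul_nonneg (mul_nonneg h0.le (Real.sqrt_nonneg _)) (norm_nonneg _))
  refine (ho.norm_sq_residual_le hχ hχc h0 h1 hρ).trans (le_of_eq ?_)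
  rw [mul_pow, mul_pow, Real.sq_sqrt (div_nonneg hB hA.le), ho.norm_sq_wavePacket h0 hρ]
  field_simp

/-- At a common point, `εt ≤ 7T/4` and `ε't ≥ 5T/4`, whereas `ε't ≤ εt/2 ≤ 7T/8`. -/
lemma wavePacket_disjoint (hT : 0 < T)
    (hs : ∀ t, χ t ≠ 0 → t ∈ Set.Icc (5 * T / 4) (7 * T / 4)) {ε' : ℝ} (h0 : 0 < ε)
    (hε : ε' ≤ ε / 2) (t : ℝ) : wavePacket ζ χ ε t = 0 ∨ wavePacket ζ χ ε' t = 0 := by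
  by_contra! hne
  have h1 := hs (ε * t) fun h0 => hne.1 (by simp [wavePacket, h0])
  have h2 := hs (ε' * t) fun h0 => hne.2 (by simp [wavePacket, h0])
  have ht : 0 < t := pos_of_mul_pos_right (lt_of_lt_of_le (by positivity) h1.1) h0.le
  have h3 := mul_le_mul_of_nonneg_right hε ht.le
  linarith [h1.2, h2.1]

lemma half_pow_le_half_pow_div_two {n k : ℕ} (hnk : n < k) :
    (1 / 2 : ℝ) ^ k ≤ (1 / 2 : ℝ) ^ n / 2 := by
  have h1 : (1 / 2 : ℝ) ^ k ≤ (1 / 2 : ℝ) ^ (n + 1) :=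
    pow_le_pow_of_le_one (by norm_num) (by norm_num) (Nat.succ_le_of_lt hnk)
  rw [pow_succ] at h1
  linarith

/-- The continuous spectrum generated by an outlet. -/
lemma IsOutlet.mem_essentialSpectrum {T : ℝ} (ho : IsOutlet (U : Set Plane) c d h T) {a lam : ℝ}
    {m : ℕ} (ha : 0 < a) (hm : 1 ≤ m) (hlam : 0 < lam) :
    ((lam + waveNumber a m ^ 2 : ℝ) : ℂ) ∈
      essentialSpectrum (maxwellOperator (productGuide a U)) := by
  -- An outlet remains one when its threshold is raised; positivity is what makes the dilated
  -- supports move outwards.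
  wlog hT : 0 < T generalizing T
  · exact this (ho.mono (le_max_left T 1)) (lt_max_of_lt_right one_pos)
  obtain ⟨χ, hχ, hχc, hs, hA⟩ := exists_envelope hT
  -- A real frequency `ζ`, hence an oscillating carrier of constant modulus, exists because `lam` is
  -- positive.
  obtain ⟨ζ, hζ⟩ : ∃ ζ : ℝ, (lam : ℂ) = (ζ : ℂ) ^ 2 :=
    ⟨Real.sqrt lam, by rw [← Complex.ofReal_pow, Real.sq_sqrt hlam.le]⟩
  have h0 : ∀ n : ℕ, 0 < (1 / 2 : ℝ) ^ n := fun n => by positivity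
  have h1 : ∀ n : ℕ, (1 / 2 : ℝ) ^ n ≤ 1 := fun n => pow_le_one₀ (by norm_num) (by norm_num)
  have hρ := fun n => isProfile_wavePacket hχ hT hs ζ (h0 n) (h1 n)
  refine mem_essentialSpectrum_of_orthogonal ha hm
    (fun n => ho.hasNeumannDivergence (hρ n)) (fun n => ho.isPlaneCurlFree (hρ n))
    (fun n => ho.isWeakGradient (hρ n).deriv.neg) (fun n hn => ?_) (fun n k hnk => ?_) ?_
  · have h2 := ho.norm_sq_wavePacket (h0 n) (hρ n)
    have h3 := mul_pos ho.height_pos (mul_pos (inv_pos.2 (h0 n)) hA)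
    rw [← h2, hn] at h3
    simp at h3
  · refine inner_stripFieldLp_eq_zero ho.norm_eq_one (hρ n) (hρ k) fun t => ?_
    rcases lt_or_gt_of_ne hnk with h2 | h2
    · exact wavePacket_disjoint hT hs (h0 n) (half_pow_le_half_pow_div_two h2) t
    · exact (wavePacket_disjoint hT hs (h0 k) (half_pow_le_half_pow_div_two h2) t).symm
  -- The relative residual is at most a constant times `2⁻ⁿ`.
  · rw [hζ]
    have hlim := (tendsto_pow_atTop_nhds_zero_of_lt_one (r := (1 / 2 : ℝ)) (by norm_num)
      (by norm_num)).mul_const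
        (Real.sqrt ((∫ t, residualEnvelope ζ χ t ^ 2) / ∫ t, χ t ^ 2))
    rw [zero_mul] at hlim
    exact squeeze_zero (fun n => div_nonneg (norm_nonneg _) (norm_nonneg _))
      (fun n => ho.norm_residual_div_le hχ hχc hA (h0 n) (h1 n) (hρ n)) hlim

end OutletFields

end

end MaxwellGuide

/-! ### The embedded eigenvalue -/

theorem mainTheorem11 (U : TopologicalSpace.Opens MaxwellGuide.Plane)
    (hconn : IsConnected (U : Set MaxwellGuide.Plane))
    (hLip : MaxwellGuide.HasLipschitzBoundary (U : Set MaxwellGuide.Plane))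
    (hstrips : MaxwellGuide.HasStripOutlets (U : Set MaxwellGuide.Plane))
    (lam : ℝ) (hlam : 0 < lam) (heig : MaxwellGuide.IsNeumannEigenvalue U lam)
    (a : ℝ) (ha : 0 < a) (m : ℕ) (hm : 1 ≤ m) :
    ((lam + (m : ℝ) ^ 2 * Real.pi ^ 2 / a ^ 2 : ℝ) : ℂ) ∈
        MaxwellGuide.embeddedEigenvalues
          (MaxwellGuide.maxwellOperator (MaxwellGuide.productGuide a U)) ∧
      ∀ φ g, MaxwellGuide.IsNeumannEigenfunction (U := U) lam φ g →
        ∃ E : (MaxwellGuide.maxwellOperator (MaxwellGuide.productGuide a U)).domain,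
          (((E : MaxwellGuide.HDiv0 (MaxwellGuide.productGuide a U)) :
              MaxwellGuide.VecL2 (MaxwellGuide.productGuide a U)) :
                MaxwellGuide.Space → EuclideanSpace ℂ (Fin 3))
            =ᵐ[MeasureTheory.volume.restrict
                (MaxwellGuide.productGuide a U : Set MaxwellGuide.Space)]
              MaxwellGuide.trappedField a m g ∧
          MaxwellGuide.IsEigenvector
            (MaxwellGuide.maxwellOperator (MaxwellGuide.productGuide a U))
            ((lam + (m : ℝ) ^ 2 * Real.pi ^ 2 / a ^ 2 : ℝ) : ℂ) E := by
  rw [MaxwellGuide.lam_add_waveNumber_sq]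
  obtain ⟨c, d, h, T, ho⟩ := hstrips.exists_isOutlet
  obtain ⟨φ, g, hφ⟩ := heig
  obtain ⟨E, -, hE⟩ := hφ.exists_isEigenvector hlam ha hm
  exact ⟨⟨⟨E, hE⟩, ho.mem_essentialSpectrum ha hm hlam⟩,
    fun φ g hφ => hφ.exists_isEigenvector hlam ha hm⟩
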